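/- For a positive integer $j$ let $$E_j=(q^j;q^j)_\infty=\prod_{m=1}^{\infty}\bigl(1-q^{jm}\bigr),$$ regarded as a formal power series in $q$ with integer coefficients (equivalently, as a function of $q$ with $|q|<1$). Since $E_1$ has constant term $1$, the quotient $E_2/E_1^3$ has a power series expansion with integer coefficients; define the integers $c(n)$, $n\ge 0$, by $$\sum_{n=0}^{\infty}c(n)q^n=\frac{E_2}{E_1^{3}}.$$ Then, for every integer $n\ge 0$, $$c(125n+99)\equiv 0\pmod{25}.$$ -/

import Mathlib

open scoped PowerSeries.WithPiTopology

/-- The `q`-Pochhammer symbol `(a; q)_∞ = ∏_{n ≥ 0} (1 - a q ^ n)` in a topological ring. -/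
noncomputable def qPochhammer {R : Type*} [CommRing R] [TopologicalSpace R] (a q : R) : R :=
  ∏' n : ℕ, (1 - a * q ^ n)

/-- `E j = (q ^ j; q ^ j)_∞`, as a formal power series in `q = PowerSeries.X` with integer
coefficients. The infinite product converges for `j ≥ 1` (see `multipliable_E`) in the topology of
coefficientwise convergence. -/
noncomputable def E (j : ℕ) : PowerSeries ℤ :=
  qPochhammer (PowerSeries.X ^ j) (PowerSeries.X ^ j)

/-- The multiplicative inverse of `E j` in `ℤ⟦q⟧` (see `E_mul_invE`). -/
noncomputable def invE (j : ℕ) : PowerSeries ℤ :=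
  PowerSeries.invOfUnit (E j) 1

/-- The integers `c n` with `∑ c n q ^ n = E 2 / E 1 ^ 3`. -/
noncomputable def c (n : ℕ) : ℤ :=
  PowerSeries.coeff n (E 2 * invE 1 ^ 3)

/-- The infinite product defining `E j` converges. -/
theorem multipliable_E {j : ℕ} (hj : 1 ≤ j) :
    Multipliable fun n : ℕ ↦
      (1 : PowerSeries ℤ) - PowerSeries.X ^ j * (PowerSeries.X ^ j) ^ n := by
  simp_rw [sub_eq_add_neg]
  apply PowerSeries.WithPiTopology.multipliable_one_add_of_tendsto_order_atTop_nhds_top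
  refine ENat.tendsto_nhds_top_iff_natCast_lt.mpr fun m ↦ Filter.eventually_atTop.mpr ⟨m, ?_⟩
  intro n hn
  rw [PowerSeries.order_neg, ← pow_mul, ← pow_add, PowerSeries.order_X_pow]
  norm_cast
  nlinarith

theorem constantCoeff_E {j : ℕ} (hj : 1 ≤ j) : PowerSeries.constantCoeff (E j) = 1 := by
  have h := (multipliable_E hj).map_tprod (PowerSeries.constantCoeff (R := ℤ))
    (PowerSeries.WithPiTopology.continuous_constantCoeff ℤ)
  have hj' : j ≠ 0 := by omega
  rw [E, qPochhammer, h]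
  simp [hj']

theorem E_mul_invE {j : ℕ} (hj : 1 ≤ j) : E j * invE j = 1 :=
  PowerSeries.mul_invOfUnit _ _ (by simp [constantCoeff_E hj])

/-- The defining property of the sequence `c`: `(∑ c n q ^ n) * E 1 ^ 3 = E 2`. -/
theorem mk_c_mul_E_one_pow : PowerSeries.mk c * E 1 ^ 3 = E 2 := by
  have h : PowerSeries.mk c = E 2 * invE 1 ^ 3 := by
    ext n
    simp [c]
  rw [h, mul_assoc, ← mul_pow, mul_comm (invE 1), E_mul_invE le_rfl, one_pow, mul_one]

/-! The numbers `c (125 n + 99)` are the coefficients of `U 3 (U 4 (U 4 (E 2 / E 1 ^ 3)))`, and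
series in `q ^ 5` pass through `U r` (`U_V_mul`). From `E 1 ^ 5 ≡ E 5` modulo 5, squaring the
difference gives `E 5 ^ 2 ≡ 2 E 5 E 1 ^ 5 - E 1 ^ 10` modulo 25. Multiplying by `E 5 ^ 2` therefore
removes the denominator `E 1 ^ 3`, and only images under `U` of a few products `E 1 ^ a * E 2 ^ b`
are needed.

These images are found from the 5-dissections of `E 1` and `E 2`, whose components are
Rogers–Ramanujan continued fractions in `q` and `q ^ 2`. Both fractions are governed by Ramanujan's
parameter `k` (`exists_parametrization`), so the identities required reduce to rational function
identities in `k`.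

The first `U 4` yields, modulo 25, a combination of `(E 1 E 2) ^ 3`, `(E 1 E 2) ^ 8` and `10 E 1 ^
4` with coefficients in `q ^ 5` (`U_four_dvd`). Under the second, `(E 1 E 2) ^ 3` becomes a multiple
of 25 and `E 1 ^ 4` a multiple of 5. The remaining one, up to a shift the newform of weight 8 and
level 2, is an eigenvector with eigenvalue -210 modulo `5 ^ 7`. What is left is `10 E 5 E 10 E 2 ^
4` (`U_four_U_four_dvd`). Finally `U 3 (E 2 ^ 4) = -5 q E 10 ^ 4` supplies the missing factor 5. -/

open PowerSeries

/-! ### Truncated Euler products and the congruence modulo 5. -/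

/-- A product of power series converges coefficientwise along initial segments. -/
theorem exists_X_pow_dvd_sub_prod {f : ℕ → PowerSeries ℤ} (hf : Multipliable f) (M : ℕ) :
    ∃ N₀, ∀ N ≥ N₀, (X : PowerSeries ℤ) ^ M ∣ (∏' n, f n) - ∏ i ∈ Finset.range N, f i := by
  have h := hf.hasProd.tendsto_prod_nat
  rw [WithPiTopology.tendsto_iff_coeff_tendsto] at h
  have h2 : ∀ d, ∀ᶠ N in Filter.atTop,
      coeff d (∏ i ∈ Finset.range N, f i) = coeff d (∏' n, f n) := by
    intro d
    have := h d
    rwa [nhds_discrete, Filter.tendsto_pure] at this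
  have h3 : ∀ᶠ N in Filter.atTop, ∀ d ∈ Finset.range M,
      coeff d (∏ i ∈ Finset.range N, f i) = coeff d (∏' n, f n) := by
    rw [Filter.eventually_all_finset]
    exact fun d _ ↦ h2 d
  obtain ⟨N₀, hN⟩ := Filter.eventually_atTop.mp h3
  refine ⟨N₀, fun N hN' ↦ ?_⟩
  rw [X_pow_dvd_iff]
  intro d hd
  rw [map_sub, hN N hN' d (Finset.mem_range.mpr hd), sub_self]

theorem eq_of_forall_X_pow_dvd_sub {f g : PowerSeries ℤ}
    (h : ∀ M : ℕ, (X : PowerSeries ℤ) ^ M ∣ f - g) : f = g := by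
  ext n
  have := X_pow_dvd_iff.mp (h (n + 1)) n (Nat.lt_succ_self n)
  rwa [map_sub, sub_eq_zero] at this

/-- The finite Euler product `∏_{i < N} (1 - q ^ (i + 1))`. -/
noncomputable def eulerProd (N : ℕ) : PowerSeries ℤ :=
  ∏ i ∈ Finset.range N, (1 - X ^ (i + 1))

theorem expand_eulerProd {j : ℕ} (hj : j ≠ 0) (N : ℕ) :
    expand j hj (eulerProd N) = ∏ i ∈ Finset.range N, (1 - X ^ (j * (i + 1))) := by
  simp [eulerProd, map_prod, expand_X, pow_mul]

theorem exists_X_pow_dvd_E_sub {j : ℕ} (hj : j ≠ 0) (M : ℕ) :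
    ∃ N₀, ∀ N ≥ N₀, (X : PowerSeries ℤ) ^ M ∣ E j - expand j hj (eulerProd N) := by
  have := exists_X_pow_dvd_sub_prod (multipliable_E (Nat.one_le_iff_ne_zero.mpr hj)) M
  simp only [expand_eulerProd]
  simpa only [E, qPochhammer, pow_mul, pow_succ'] using this

theorem exists_X_pow_dvd_E_one_sub (M : ℕ) :
    ∃ N₀, ∀ N ≥ N₀, (X : PowerSeries ℤ) ^ M ∣ E 1 - eulerProd N := by
  simpa using exists_X_pow_dvd_E_sub one_ne_zero M

theorem X_pow_dvd_expand {p : ℕ} (hp : p ≠ 0) {M : ℕ} {f : PowerSeries ℤ} (h : X ^ M ∣ f) :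
    X ^ M ∣ expand p hp f := by
  obtain ⟨g, rfl⟩ := h
  rw [map_mul, map_pow, expand_X, ← pow_mul]
  exact (pow_dvd_pow X (Nat.le_mul_of_pos_left M (Nat.pos_of_ne_zero hp))).mul_right _

theorem expand_E {p j : ℕ} (hp : p ≠ 0) (hj : j ≠ 0) : expand p hp (E j) = E (p * j) := by
  apply eq_of_forall_X_pow_dvd_sub
  intro M
  obtain ⟨N₁, h₁⟩ := exists_X_pow_dvd_E_sub hj M
  obtain ⟨N₂, h₂⟩ := exists_X_pow_dvd_E_sub (mul_ne_zero hp hj) M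
  have h3 := X_pow_dvd_expand hp (h₁ _ (le_max_left N₁ N₂))
  have h4 := h₂ _ (le_max_right N₁ N₂)
  rw [map_sub, ← expand_mul] at h3
  have := dvd_sub h3 h4
  simpa using this

theorem E_ne_zero {j : ℕ} (hj : j ≠ 0) : E j ≠ 0 := by
  intro h
  have := constantCoeff_E (Nat.one_le_iff_ne_zero.mpr hj)
  rw [h] at this
  simp at this

theorem intCast_dvd_iff {m : ℤ} {f : PowerSeries ℤ} :
    (m : PowerSeries ℤ) ∣ f ↔ ∀ n, m ∣ coeff n f := by
  have hm : (m : PowerSeries ℤ) = C m := by simp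
  constructor
  · rintro ⟨g, rfl⟩ n
    rw [hm, coeff_C_mul]
    exact dvd_mul_right _ _
  · intro h
    choose g hg using h
    refine ⟨mk g, ?_⟩
    ext n
    rw [hm, coeff_C_mul, coeff_mk, hg]

/-- `E 5` is congruent to `E 1 ^ 5` modulo `5`. -/
theorem five_dvd_E_one_pow_sub : (5 : PowerSeries ℤ) ∣ E 1 ^ 5 - E 5 := by
  have key : ∀ N, (5 : PowerSeries ℤ) ∣
      eulerProd N ^ 5 - expand 5 (by norm_num) (eulerProd N) := by
    intro N
    rw [expand_eulerProd, eulerProd, ← Finset.prod_pow]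
    rw [← Ideal.mem_span_singleton, ← Ideal.Quotient.eq, map_prod, map_prod]
    apply Finset.prod_congr rfl
    intro i _
    rw [Ideal.Quotient.eq, Ideal.mem_span_singleton, pow_mul']
    generalize (X : PowerSeries ℤ) ^ (i + 1) = y
    exact ⟨-y + 2 * y ^ 2 - 2 * y ^ 3 + y ^ 4, by ring⟩
  have h5 : (5 : PowerSeries ℤ) = ((5 : ℤ) : PowerSeries ℤ) := by norm_num
  rw [h5, intCast_dvd_iff]
  intro n
  obtain ⟨N₁, h₁⟩ := exists_X_pow_dvd_E_one_sub (n + 1)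
  obtain ⟨N₂, h₂⟩ := exists_X_pow_dvd_E_sub (j := 5) (by norm_num) (n + 1)
  have h3 := h₁ _ (le_max_left N₁ N₂)
  have h4 := h₂ _ (le_max_right N₁ N₂)
  have h5' := key (max N₁ N₂)
  rw [h5, intCast_dvd_iff] at h5'
  have h6 := (h3.trans (sub_dvd_pow_sub_pow (E 1) _ 5)).sub h4
  have h7 := X_pow_dvd_iff.mp h6 n (Nat.lt_succ_self n)
  have h8 := h5' n
  simp only [map_sub] at h7 h8 ⊢
  have : (coeff n) (E 1 ^ 5) - (coeff n) (E 5) = coeff n (eulerProd (max N₁ N₂) ^ 5)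
    - coeff n (expand 5 (by norm_num) (eulerProd (max N₁ N₂))) := by linarith
  rwa [this]

theorem five_dvd_E_two_pow_sub : (5 : PowerSeries ℤ) ∣ E 2 ^ 5 - E 10 := by
  have := map_dvd (expand (R := ℤ) 2 two_ne_zero) five_dvd_E_one_pow_sub
  rwa [map_sub, map_pow, expand_E _ one_ne_zero, expand_E _ (by norm_num), map_ofNat] at this

/-! ### The operators of 5-dissection. -/

/-- The substitution `q ↦ q ^ 5`. -/
noncomputable def V : PowerSeries ℤ →+* PowerSeries ℤ :=
  (expand 5 (by norm_num) : PowerSeries ℤ →ₐ[ℤ] PowerSeries ℤ).toRingHom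

theorem V_apply (f : PowerSeries ℤ) : V f = expand 5 (by norm_num) f := rfl

theorem coeff_V (f : PowerSeries ℤ) (n : ℕ) :
    coeff n (V f) = if 5 ∣ n then coeff (n / 5) f else 0 := by
  rw [V_apply, coeff_expand]

theorem V_X : V X = X ^ 5 := by rw [V_apply, expand_X]

theorem V_injective : Function.Injective V := by
  intro f g h
  ext n
  have := congrArg (coeff (5 * n)) h
  simpa [coeff_V] using this

theorem V_E {j : ℕ} (hj : j ≠ 0) : V (E j) = E (5 * j) := expand_E _ hj

/-- The series of the coefficients of index congruent to `r` modulo `5`. -/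
noncomputable def U (r : ℕ) : PowerSeries ℤ →+ PowerSeries ℤ where
  toFun f := mk fun n ↦ coeff (5 * n + r) f
  map_zero' := by ext; simp
  map_add' f g := by ext; simp

theorem coeff_U (r n : ℕ) (f : PowerSeries ℤ) : coeff n (U r f) = coeff (5 * n + r) f := by
  simp [U]

theorem U_X_pow_mul_V {r i : ℕ} (hr : r < 5) (hi : i < 5) (f : PowerSeries ℤ) :
    U r (X ^ i * V f) = if r = i then f else 0 := by
  ext n
  rw [coeff_U, coeff_X_pow_mul', coeff_V]
  split_ifs with h1 h2 h3 h3 h3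
  · subst h3
    congr 2
    omega
  · omega
  · omega
  · rw [map_zero]
  · omega
  · rw [map_zero]

theorem eq_sum_X_pow_mul_V_U (f : PowerSeries ℤ) :
    f = ∑ i ∈ Finset.range 5, X ^ i * V (U i f) := by
  ext n
  have hterm : ∀ i ∈ Finset.range 5, coeff n (X ^ i * V (U i f)) =
      if i = n % 5 then coeff n f else 0 := by
    intro i hi
    rw [Finset.mem_range] at hi
    rw [coeff_X_pow_mul', coeff_V, coeff_U]
    split_ifs with h1 h2 h3 h3 h3
    · congr 2
      omega
    · omega
    · omega
    · rfl
    · omega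
    · rfl
  rw [map_sum, Finset.sum_congr rfl hterm, Finset.sum_ite_eq', if_pos]
  exact Finset.mem_range.mpr (Nat.mod_lt _ (by norm_num))

/-- A factor in `q ^ 5` does not change residues of exponents modulo 5. This is how `E 5` and `E 10`
come out of `U r` as `E 1` and `E 2`. -/
theorem U_V_mul {r : ℕ} (hr : r < 5) (f g : PowerSeries ℤ) : U r (V f * g) = f * U r g := by
  conv_lhs => rw [eq_sum_X_pow_mul_V_U g, Finset.mul_sum]
  rw [map_sum, Finset.sum_eq_single_of_mem r (Finset.mem_range.mpr hr)]
  · rw [mul_left_comm, ← map_mul, U_X_pow_mul_V hr hr, if_pos rfl]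
  · intro i hi hne
    rw [mul_left_comm, ← map_mul, U_X_pow_mul_V hr (Finset.mem_range.mp hi), if_neg hne.symm]

/-- Reading off the `5`-dissection of a power series. -/
theorem U_sum {r : ℕ} (hr : r < 5) (f₀ f₁ f₂ f₃ f₄ : PowerSeries ℤ) :
    U r (V f₀ + X * V f₁ + X ^ 2 * V f₂ + X ^ 3 * V f₃ + X ^ 4 * V f₄) =
      if r = 0 then f₀ else if r = 1 then f₁ else if r = 2 then f₂ else if r = 3 then f₃
        else f₄ := by
  have h0 := U_X_pow_mul_V hr (i := 0) (by norm_num) f₀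
  have h1 := U_X_pow_mul_V hr (i := 1) (by norm_num) f₁
  rw [pow_zero, one_mul] at h0
  rw [pow_one] at h1
  simp only [map_add, h0, h1, U_X_pow_mul_V hr (i := 2) (by norm_num) f₂,
    U_X_pow_mul_V hr (i := 3) (by norm_num) f₃, U_X_pow_mul_V hr (i := 4) (by norm_num) f₄]
  interval_cases r <;> simp

theorem U_mul_const {r : ℕ} (m : ℤ) (f : PowerSeries ℤ) :
    U r ((m : PowerSeries ℤ) * f) = m * U r f := by
  rw [← zsmul_eq_mul, map_zsmul, zsmul_eq_mul]

theorem intCast_dvd_U {r : ℕ} {m : ℤ} {f : PowerSeries ℤ} (h : (m : PowerSeries ℤ) ∣ f) :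
    (m : PowerSeries ℤ) ∣ U r f := by
  obtain ⟨g, rfl⟩ := h
  exact ⟨U r g, U_mul_const m g⟩

/-! ### Gaussian binomials and finite theta identities. -/

/-- The Gaussian binomial coefficient `[n, k]` at `q`. -/
def gaussBinom {R : Type*} [CommRing R] (q : R) : ℕ → ℕ → R
  | _, 0 => 1
  | 0, _ + 1 => 0
  | n + 1, k + 1 => gaussBinom q n (k + 1) + q ^ (n - k) * gaussBinom q n k

section gaussBinom
variable {R S : Type*} [CommRing R] [CommRing S]

@[simp] theorem gaussBinom_zero_right (q : R) (n : ℕ) : gaussBinom q n 0 = 1 := by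
  cases n <;> rfl

theorem gaussBinom_succ_succ (q : R) (n k : ℕ) : gaussBinom q (n + 1) (k + 1) =
    gaussBinom q n (k + 1) + q ^ (n - k) * gaussBinom q n k := rfl

theorem gaussBinom_eq_zero (q : R) {n k : ℕ} (h : n < k) : gaussBinom q n k = 0 := by
  induction n generalizing k with
  | zero =>
    cases k with
    | zero => omega
    | succ k => rfl
  | succ n ih =>
    cases k with
    | zero => omega
    | succ k => rw [gaussBinom_succ_succ, ih (by omega), ih (by omega)]; simp

theorem map_gaussBinom (f : R →+* S) (q : R) (n k : ℕ) :
    f (gaussBinom q n k) = gaussBinom (f q) n k := by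
  induction n generalizing k with
  | zero => cases k <;> simp [gaussBinom]
  | succ n ih =>
    cases k with
    | zero => simp
    | succ k => simp [gaussBinom_succ_succ, ih]

/-- The homogeneous form of the `q`-binomial theorem. -/
theorem prod_add_mul_pow (q x y : R) (n : ℕ) :
    ∏ i ∈ Finset.range n, (x + y * q ^ i) = ∑ k ∈ Finset.range (n + 1),
      q ^ (k.choose 2) * gaussBinom q n k * y ^ k * x ^ (n - k) := by
  induction n with
  | zero => simp
  | succ n ih =>
    have hB : ∑ k ∈ Finset.range (n + 1), q ^ ((k + 1).choose 2) *
        (q ^ (n - k) * gaussBinom q n k) * y ^ (k + 1) * x ^ (n - k) =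
        y * q ^ n * ∑ k ∈ Finset.range (n + 1),
          q ^ (k.choose 2) * gaussBinom q n k * y ^ k * x ^ (n - k) := by
      rw [Finset.mul_sum]
      refine Finset.sum_congr rfl fun k hk ↦ ?_
      have hk' : n = k + (n - k) := by have := Finset.mem_range.mp hk; omega
      have h2 : (k + 1).choose 2 = k + k.choose 2 := by simp [Nat.choose_succ_succ']
      rw [h2]
      conv_rhs => rw [hk', pow_add q k, ← hk']
      ring
    have hA : ∑ k ∈ Finset.range (n + 1), q ^ ((k + 1).choose 2) *
        gaussBinom q n (k + 1) * y ^ (k + 1) * x ^ (n - k) + x ^ (n + 1) =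
        x * ∑ k ∈ Finset.range (n + 1),
          q ^ (k.choose 2) * gaussBinom q n k * y ^ k * x ^ (n - k) := by
      rw [Finset.sum_range_succ, gaussBinom_eq_zero q (Nat.lt_succ_self n),
        Finset.sum_range_succ' _ n, mul_add, Finset.mul_sum]
      have : ∀ k ∈ Finset.range n, q ^ ((k + 1).choose 2) *
        gaussBinom q n (k + 1) * y ^ (k + 1) * x ^ (n - k) = x * (q ^ ((k + 1).choose 2) *
        gaussBinom q n (k + 1) * y ^ (k + 1) * x ^ (n - (k + 1))) := by
        intro k hk
        have hk' : n - k = (n - (k + 1)) + 1 := by have := Finset.mem_range.mp hk; omega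
        rw [hk', pow_succ]
        ring
      rw [Finset.sum_congr rfl this]
      simp [pow_succ']
    rw [Finset.prod_range_succ, ih, Finset.sum_range_succ' _ (n + 1)]
    simp only [gaussBinom_succ_succ, Nat.add_sub_add_right, mul_add, add_mul,
      Finset.sum_add_distrib]
    rw [hB, mul_comm _ x, ← hA]
    simp
    ring

end gaussBinom

theorem eulerProd_succ (n : ℕ) : eulerProd (n + 1) = eulerProd n * (1 - X ^ (n + 1)) := by
  rw [eulerProd, Finset.prod_range_succ]; rfl

theorem gaussBinom_mul_eulerProd_mul_eulerProd (i j : ℕ) :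
    gaussBinom X (i + j) i * eulerProd i * eulerProd j = eulerProd (i + j) := by
  obtain ⟨n, hn⟩ : ∃ n, i + j = n := ⟨_, rfl⟩
  induction n generalizing i j with
  | zero =>
    obtain ⟨rfl, rfl⟩ : i = 0 ∧ j = 0 := by omega
    simp [eulerProd]
  | succ n ih =>
    rcases i with _ | i
    · simp [eulerProd]
    rcases j with _ | j
    · have h1 := ih i 0 (by omega)
      rw [Nat.add_zero] at h1 ⊢
      rw [gaussBinom_succ_succ, gaussBinom_eq_zero _ (Nat.lt_succ_self i), eulerProd_succ]
      have h0 : eulerProd 0 = 1 := by simp [eulerProd]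
      rw [h0] at h1 ⊢
      rw [Nat.sub_self]
      linear_combination (1 - X ^ (i + 1)) * h1
    · have h1 := ih (i + 1) j (by omega)
      have h2 := ih i (j + 1) (by omega)
      have e : i + 1 + (j + 1) = (i + 1 + j) + 1 := by ring
      have e2 : i + (j + 1) = i + 1 + j := by ring
      rw [e2] at h2
      rw [e, gaussBinom_succ_succ, eulerProd_succ (i + 1 + j), show i + 1 + j - i = j + 1 by omega]
      rw [eulerProd_succ j] at h2 ⊢
      rw [eulerProd_succ i] at h1 ⊢
      linear_combination (1 - X ^ (j + 1)) * h1 + X ^ (j + 1) * (1 - X ^ (i + 1)) * h2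

theorem X_pow_dvd_eulerProd_sub {m n : ℕ} (h : m ≤ n) :
    (X : PowerSeries ℤ) ^ (m + 1) ∣ eulerProd n - eulerProd m := by
  induction n, h using Nat.le_induction with
  | base => simp
  | succ n hn ih =>
    rw [eulerProd_succ]
    have : (X : PowerSeries ℤ) ^ (m + 1) ∣ X ^ (n + 1) := pow_dvd_pow _ (by omega)
    have h2 := ih.sub (this.mul_left (eulerProd n))
    convert h2 using 1
    ring

theorem X_pow_dvd_E_one_sub (n : ℕ) : (X : PowerSeries ℤ) ^ (n + 1) ∣ E 1 - eulerProd n := by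
  obtain ⟨N₀, h⟩ := exists_X_pow_dvd_E_one_sub (n + 1)
  have h1 := h _ (le_max_left N₀ n)
  have h2 := X_pow_dvd_eulerProd_sub (le_max_right N₀ n)
  simpa using h1.add h2

/-- `[n, k]` tends to `1 / E 1` when `k` and `n - k` tend to infinity. -/
theorem X_pow_dvd_gaussBinom_mul_E_one_sub {M i j : ℕ} (hi : M ≤ i) (hj : M ≤ j) :
    (X : PowerSeries ℤ) ^ M ∣ gaussBinom X (i + j) i * E 1 - 1 := by
  have hle : ∀ k, M ≤ k → (X : PowerSeries ℤ) ^ M ∣ E 1 - eulerProd k := fun k hk ↦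
    (pow_dvd_pow X (by omega)).trans (X_pow_dvd_E_one_sub k)
  have h := gaussBinom_mul_eulerProd_mul_eulerProd i j
  have h0 : E 1 * invE 1 = 1 := E_mul_invE le_rfl
  obtain ⟨a, ha⟩ := hle i hi
  obtain ⟨b, hb⟩ := hle j hj
  obtain ⟨c, hc⟩ := hle (i + j) (by omega)
  rw [show eulerProd i = E 1 - X ^ M * a by linear_combination -ha,
    show eulerProd j = E 1 - X ^ M * b by linear_combination -hb,
    show eulerProd (i + j) = E 1 - X ^ M * c by linear_combination -hc] at h
  set g := gaussBinom (X : PowerSeries ℤ) (i + j) i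
  refine ⟨invE 1 * (g * a * E 1 + g * b * E 1 - g * X ^ M * a * b - c), ?_⟩
  linear_combination invE 1 * h + (1 - g * E 1) * h0

theorem coeff_eq_of_X_pow_dvd_sub {f g : PowerSeries ℤ} {M d : ℕ} (h : X ^ M ∣ f - g)
    (hd : d < M) : coeff d f = coeff d g := by
  have := X_pow_dvd_iff.mp h d hd
  rwa [map_sub, sub_eq_zero] at this

theorem prod_X_pow_sub_X_pow (n : ℕ) :
    ∏ i ∈ Finset.range n, ((X : PowerSeries ℤ) ^ n - X ^ i) =
      (-1) ^ n * X ^ (n.choose 2) * eulerProd n := by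
  have h1 : ∀ i ∈ Finset.range n, (X : PowerSeries ℤ) ^ n - X ^ (n - 1 - i) =
      -1 * X ^ (n - 1 - i) * (1 - X ^ (i + 1)) := by
    intro i hi
    have : n = (n - 1 - i) + (i + 1) := by have := Finset.mem_range.mp hi; omega
    conv_lhs => rw [this, pow_add, ← this]
    ring
  rw [← Finset.prod_range_reflect, Finset.prod_congr rfl h1, Finset.prod_mul_distrib,
    Finset.prod_mul_distrib, Finset.prod_const, Finset.card_range,
    Finset.prod_range_reflect (fun i ↦ (X : PowerSeries ℤ) ^ i), Finset.prod_pow_eq_pow_sum,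
    Finset.sum_range_id, Nat.choose_two_right, eulerProd]

theorem prod_X_pow_sub_X_pow_add (n : ℕ) :
    ∏ i ∈ Finset.range n, ((X : PowerSeries ℤ) ^ n - X ^ (n + (i + 1))) =
      X ^ (n * n) * eulerProd n := by
  have h1 : ∀ i ∈ Finset.range n, (X : PowerSeries ℤ) ^ n - X ^ (n + (i + 1)) =
      X ^ n * (1 - X ^ (i + 1)) := by
    intro i _
    rw [pow_add]; ring
  rw [Finset.prod_congr rfl h1, Finset.prod_mul_distrib, Finset.prod_const, Finset.card_range,
    ← pow_mul, eulerProd]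

/-- The triangular number `j (j - 1) / 2` for `j = k - n`. -/
def shiftedTriangle (n k : ℕ) : ℕ := (((k : ℤ) - n) * (k - n - 1) / 2).toNat

theorem two_mul_shiftedTriangle (n k : ℕ) :
    2 * (shiftedTriangle n k : ℤ) = ((k : ℤ) - n) * (k - n - 1) := by
  have he : Even (((k : ℤ) - n) * (k - n - 1)) := by
    have := Int.even_mul_succ_self ((k : ℤ) - n - 1)
    rwa [sub_add_cancel, mul_comm] at this
  have hn : 0 ≤ ((k : ℤ) - n) * (k - n - 1) := by
    rcases le_or_gt (k : ℤ) n with h | h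
    · exact mul_nonneg_of_nonpos_of_nonpos (by linarith) (by linarith)
    · exact mul_nonneg (by linarith) (by linarith [Int.add_one_le_of_lt h])
  rw [shiftedTriangle, Int.toNat_of_nonneg (Int.ediv_nonneg hn (by norm_num)),
    Int.mul_ediv_cancel' he.two_dvd]

theorem two_mul_choose_two (n : ℕ) : 2 * ((n.choose 2 : ℕ) : ℤ) = n * (n - 1) := by
  induction n with
  | zero => simp
  | succ n ih =>
    have h2 : (n + 1).choose 2 = n + n.choose 2 := by simp [Nat.choose_succ_succ']
    rw [h2]; push_cast; linear_combination ih

/-- A finite form of Jacobi's identity for the cube of the Euler product. -/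
theorem eulerProd_sq_eq_sum (n : ℕ) :
    (-1) ^ (n + 1) * eulerProd n ^ 2 = ∑ k ∈ Finset.range (2 * n + 1 + 1),
      (k : PowerSeries ℤ) * (-1) ^ k * X ^ shiftedTriangle n k * gaussBinom X (2 * n + 1) k := by
  -- With `z` a polynomial variable, the factor of index `n` is `q ^ n * (1 - z)`. Hence the
  -- derivative at `z = 1` keeps only the product of the other `2 n` factors, while on the sum side
  -- it turns `z ^ k` into the weight `k`.
  have h := prod_add_mul_pow (Polynomial.C (X : PowerSeries ℤ)) (Polynomial.C (X ^ n))
    (-Polynomial.X) (2 * n + 1)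
  have hL : ∏ i ∈ Finset.range (2 * n + 1), (Polynomial.C ((X : PowerSeries ℤ) ^ n) +
      -Polynomial.X * Polynomial.C X ^ i) =
      (∏ i ∈ Finset.range n, (Polynomial.C ((X : PowerSeries ℤ) ^ n) +
        -Polynomial.X * Polynomial.C X ^ i)) *
      ((∏ i ∈ Finset.range n, (Polynomial.C ((X : PowerSeries ℤ) ^ n) +
        -Polynomial.X * Polynomial.C X ^ (n + (i + 1)))) *
        (Polynomial.C (X ^ n) * (1 - Polynomial.X))) := by
    rw [show 2 * n + 1 = n + (n + 1) by ring, Finset.prod_range_add, Finset.prod_range_succ']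
    simp only [add_zero, map_pow]
    ring
  rw [hL] at h
  have h2 := congrArg (fun p ↦ Polynomial.eval 1 (Polynomial.derivative p)) h
  have hR : ∀ k ∈ Finset.range (2 * n + 1 + 1), Polynomial.eval 1 (Polynomial.derivative
      (Polynomial.C (X : PowerSeries ℤ) ^ k.choose 2 *
        gaussBinom (Polynomial.C X) (2 * n + 1) k * (-Polynomial.X) ^ k *
          Polynomial.C (X ^ n) ^ (2 * n + 1 - k))) = X ^ (n + n * n + n.choose 2) *
      ((k : PowerSeries ℤ) * (-1) ^ k * X ^ shiftedTriangle n k *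
        gaussBinom X (2 * n + 1) k) := by
    intro k hk
    have hk' : k ≤ 2 * n + 1 := by have := Finset.mem_range.mp hk; omega
    have he : k.choose 2 + n * (2 * n + 1 - k) =
        n + n * n + n.choose 2 + shiftedTriangle n k := by
      have h1 := two_mul_shiftedTriangle n k
      have h2 := two_mul_choose_two n
      have h3 := two_mul_choose_two k
      zify [hk']
      linarith
    rw [← map_gaussBinom, neg_pow (Polynomial.X : Polynomial (PowerSeries ℤ)), show Polynomial.C (X : PowerSeries ℤ) ^ k.choose 2 *
        Polynomial.C (gaussBinom X (2 * n + 1) k) * ((-1) ^ k * Polynomial.X ^ k) *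
          Polynomial.C (X ^ n) ^ (2 * n + 1 - k) = Polynomial.C (X ^ k.choose 2 *
          gaussBinom X (2 * n + 1) k * (-1) ^ k * (X ^ n) ^ (2 * n + 1 - k)) *
          Polynomial.X ^ k by simp only [map_mul, map_pow, map_neg, map_one]; ring]
    rw [Polynomial.derivative_C_mul, Polynomial.derivative_X_pow, ← pow_mul]
    simp only [Polynomial.eval_mul, Polynomial.eval_C,
      Polynomial.eval_pow, Polynomial.eval_X, one_pow, mul_one]
    have := pow_add (X : PowerSeries ℤ) (k.choose 2) (n * (2 * n + 1 - k))
    rw [he, pow_add] at this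
    linear_combination -((k : PowerSeries ℤ) * (-1) ^ k * gaussBinom X (2 * n + 1) k) * this
  simp only [Polynomial.derivative_sum, Polynomial.eval_finsetSum] at h2
  rw [Finset.sum_congr rfl hR, ← Finset.mul_sum] at h2
  have hX : (X : PowerSeries ℤ) ^ (n + n * n + n.choose 2) ≠ 0 := pow_ne_zero _ X_ne_zero
  apply mul_left_cancel₀ hX
  rw [← h2]
  have e1 := prod_X_pow_sub_X_pow n
  have e2 := prod_X_pow_sub_X_pow_add n
  simp only [Polynomial.derivative_mul, Polynomial.eval_add, Polynomial.eval_mul,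
    Polynomial.derivative_C, Polynomial.derivative_sub, Polynomial.derivative_one,
    Polynomial.derivative_X, Polynomial.eval_sub, Polynomial.eval_one, Polynomial.eval_X,
    Polynomial.eval_C, Polynomial.eval_prod, Polynomial.eval_neg, Polynomial.eval_pow,
    Polynomial.eval_zero, neg_mul, one_mul, ← sub_eq_add_neg, e1, e2]
  ring

theorem eulerProd_two_mul (n : ℕ) : eulerProd (2 * n) =
    (∏ i ∈ Finset.range n, (1 - X ^ (2 * i + 1))) * expand 2 two_ne_zero (eulerProd n) := by
  rw [expand_eulerProd]
  induction n with
  | zero => simp [eulerProd]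
  | succ n ih =>
    rw [show 2 * (n + 1) = 2 * n + 1 + 1 by ring, eulerProd_succ, eulerProd_succ, ih,
      Finset.prod_range_succ, Finset.prod_range_succ, show 2 * (n + 1) = 2 * n + 1 + 1 by ring]
    ring

/-- A finite form of Gauss's identity for `E 1 ^ 2 / E 2`. -/
theorem prod_odd_sq_eq_sum (n : ℕ) :
    (-1) ^ n * (∏ i ∈ Finset.range n, (1 - (X : PowerSeries ℤ) ^ (2 * i + 1))) ^ 2 =
      ∑ k ∈ Finset.range (2 * n + 1),
        (-1) ^ k * X ^ (((k : ℤ) - n) ^ 2).toNat * gaussBinom (X ^ 2) (2 * n) k := by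
  -- With base `q ^ 2`, the factors below and above the middle pair up: each `1 - q ^ (2 i + 1)`
  -- occurs once in each half.
  have h := prod_add_mul_pow ((X : PowerSeries ℤ) ^ 2) (X ^ (2 * n)) (-X) (2 * n)
  have hR : ∀ k ∈ Finset.range (2 * n + 1), ((X : PowerSeries ℤ) ^ 2) ^ k.choose 2 *
        gaussBinom (X ^ 2) (2 * n) k * (-X) ^ k * (X ^ (2 * n)) ^ (2 * n - k) =
      X ^ (3 * n * n) * ((-1) ^ k * X ^ (((k : ℤ) - n) ^ 2).toNat *
        gaussBinom (X ^ 2) (2 * n) k) := by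
    intro k hk
    have hk' : k ≤ 2 * n := by have := Finset.mem_range.mp hk; omega
    have he : 2 * k.choose 2 + k + 2 * n * (2 * n - k) =
        3 * n * n + (((k : ℤ) - n) ^ 2).toNat := by
      have h3 := two_mul_choose_two k
      zify [hk']
      rw [Int.toNat_of_nonneg (sq_nonneg _)]
      linarith
    have := congrArg (fun e ↦ (X : PowerSeries ℤ) ^ e) he
    simp only [pow_add] at this
    rw [neg_pow X, ← pow_mul, ← pow_mul]
    linear_combination ((-1) ^ k * gaussBinom (X ^ 2) (2 * n) k : PowerSeries ℤ) * this
  have hL : ∏ i ∈ Finset.range (2 * n), ((X : PowerSeries ℤ) ^ (2 * n) + -X * (X ^ 2) ^ i) =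
      X ^ (3 * n * n) * ((-1) ^ n *
        (∏ i ∈ Finset.range n, (1 - (X : PowerSeries ℤ) ^ (2 * i + 1))) ^ 2) := by
    have h1 : ∀ i ∈ Finset.range n, (X : PowerSeries ℤ) ^ (2 * n) +
        -X * (X ^ 2) ^ (n - 1 - i) = -1 * X ^ (2 * (n - 1 - i) + 1) * (1 - X ^ (2 * i + 1)) := by
      intro i hi
      have : 2 * n = (2 * (n - 1 - i) + 1) + (2 * i + 1) := by
        have := Finset.mem_range.mp hi; omega
      rw [congrArg (fun e ↦ (X : PowerSeries ℤ) ^ e) this, pow_add _ _ (2 * i + 1), ← pow_mul]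
      ring
    have h2 : ∀ i ∈ Finset.range n, (X : PowerSeries ℤ) ^ (2 * n) +
        -X * (X ^ 2) ^ (n + i) = X ^ (2 * n) * (1 - X ^ (2 * i + 1)) := by
      intro i _
      rw [← pow_mul]
      ring
    have h3 : ∀ n, ∑ i ∈ Finset.range n, (2 * i + 1) = n * n := by
      intro n
      induction n with
      | zero => simp
      | succ n ih => rw [Finset.sum_range_succ, ih]; ring
    conv_lhs => rw [two_mul n, Finset.prod_range_add, ← two_mul n]
    rw [Finset.prod_congr rfl h2, ← Finset.prod_range_reflect, Finset.prod_congr rfl h1,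
      Finset.prod_mul_distrib, Finset.prod_mul_distrib, Finset.prod_const, Finset.card_range,
      Finset.prod_range_reflect (fun i ↦ (X : PowerSeries ℤ) ^ (2 * i + 1)),
      Finset.prod_pow_eq_pow_sum, Finset.prod_mul_distrib, Finset.prod_const, Finset.card_range,
      h3]
    ring
  rw [hL, Finset.sum_congr rfl hR, ← Finset.mul_sum] at h
  exact mul_left_cancel₀ (pow_ne_zero _ X_ne_zero) h

/-! ### Vanishing of theta coefficients in residue classes modulo 5. -/

/-- Here `f` is a Gaussian binomial times an Euler product. In the central range it is 1 up to
degree `M`, so the term is a single monomial; in the tails the exponent `t` already exceeds `d`. -/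
theorem coeff_X_pow_mul_eq_zero {f : PowerSeries ℤ} {M t d : ℕ}
    (h : d < t ∨ (t ≠ d ∧ X ^ M ∣ f - 1 ∧ d < M)) : coeff d (X ^ t * f) = 0 := by
  rcases h with h | ⟨h1, h2, h3⟩
  · rw [coeff_X_pow_mul', if_neg (by omega)]
  · have : X ^ M ∣ X ^ t * f - X ^ t := by
      rw [← mul_sub_one]
      exact h2.mul_left _
    rw [coeff_eq_of_X_pow_dvd_sub this h3, coeff_X_pow, if_neg h1.symm]

theorem coeff_neg_one_pow_mul_eq_zero {f : PowerSeries ℤ} {k d : ℕ}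
    (h : coeff d f = 0) : coeff d ((-1) ^ k * f) = 0 := by
  rcases neg_one_pow_eq_or (PowerSeries ℤ) k with h1 | h1 <;> simp [h1, h]

/-- The coefficients of `E 1 ^ 3` of index congruent to `2` modulo `5` vanish. -/
theorem U_two_E_one_pow_three : U 2 (E 1 ^ 3) = 0 := by
  ext m
  rw [coeff_U, map_zero]
  set d := 5 * m + 2 with hd
  -- Large enough that every `k` within `d` of either end of the sum has triangular exponent above
  -- `d`.
  set n := 3 * (d + 1) + 3 with hn
  have h1 : (X : PowerSeries ℤ) ^ (d + 1) ∣ E 1 ^ 3 - E 1 * eulerProd n ^ 2 := by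
    have := (pow_dvd_pow X (by omega)).trans (X_pow_dvd_E_one_sub n) (a := X ^ (d + 1))
    have h2 := (this.trans (sub_dvd_pow_sub_pow (E 1) _ 2)).mul_left (E 1)
    convert h2 using 1
    ring
  rw [coeff_eq_of_X_pow_dvd_sub h1 (Nat.lt_succ_self d)]
  have h2 : coeff d (E 1 * ((-1) ^ (n + 1) * eulerProd n ^ 2)) = 0 := by
    rw [eulerProd_sq_eq_sum, Finset.mul_sum, map_sum]
    refine Finset.sum_eq_zero fun k hk ↦ ?_
    have hk' : k ≤ 2 * n + 1 := by have := Finset.mem_range.mp hk; omega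
    have hz : coeff d (X ^ shiftedTriangle n k * (gaussBinom X (2 * n + 1) k * E 1)) = 0 := by
      have h2t := two_mul_shiftedTriangle n k
      apply coeff_X_pow_mul_eq_zero (M := d + 1)
      by_cases hc : d + 1 ≤ k ∧ d + 1 ≤ 2 * n + 1 - k
      · right
        refine ⟨?_, ?_, Nat.lt_succ_self d⟩
        · intro ht
          rw [ht, hd] at h2t
          generalize (k : ℤ) - n = j at h2t
          push_cast at h2t
          -- Twice a triangular number is 0, 1 or 2 modulo 5, whereas `2 d` is 4.
          have h5 : (j * (j - 1)) % 5 = 4 := by omega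
          have h6 : j % 5 = 0 ∨ j % 5 = 1 ∨ j % 5 = 2 ∨ j % 5 = 3 ∨ j % 5 = 4 := by omega
          rcases h6 with h | h | h | h | h <;> simp [Int.mul_emod, Int.sub_emod, h] at h5
        · have := X_pow_dvd_gaussBinom_mul_E_one_sub hc.1 hc.2
          rwa [Nat.add_sub_cancel' hk'] at this
      · left
        zify
        rcases not_and_or.mp hc with hc | hc
        · have : (n : ℤ) - k ≥ 2 * (d + 1) + 3 := by omega
          nlinarith
        · have : (k : ℤ) - n ≥ 2 * (d + 1) + 3 := by omega
          nlinarith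
    have e : E 1 * ((k : PowerSeries ℤ) * (-1) ^ k * X ^ shiftedTriangle n k *
        gaussBinom X (2 * n + 1) k) = (-1) ^ k * (((k : ℤ) : PowerSeries ℤ) *
        (X ^ shiftedTriangle n k * (gaussBinom X (2 * n + 1) k * E 1))) := by
      push_cast; ring
    rw [e]
    apply coeff_neg_one_pow_mul_eq_zero
    rw [← zsmul_eq_mul, map_zsmul, hz, smul_zero]
  rw [mul_left_comm] at h2
  have h3 := coeff_neg_one_pow_mul_eq_zero (k := n + 1) h2
  rwa [← mul_assoc, ← pow_add, Even.neg_one_pow ⟨n + 1, rfl⟩, one_mul] at h3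

/-- The theta function `E 1 ^ 2 / E 2`. -/
noncomputable def gaussTheta : PowerSeries ℤ := E 1 ^ 2 * invE 2

theorem E_two_mul_gaussTheta : E 2 * gaussTheta = E 1 ^ 2 := by
  rw [gaussTheta, mul_left_comm, E_mul_invE (by norm_num), mul_one]

theorem coeff_gaussTheta_eq_zero {d : ℕ} (hd : d % 5 = 2 ∨ d % 5 = 3) :
    coeff d gaussTheta = 0 := by
  set n := 2 * (d + 1) with hn
  set O := ∏ i ∈ Finset.range n, (1 - (X : PowerSeries ℤ) ^ (2 * i + 1)) with hO
  -- The odd product `O` approximates `E 1 / E 2`, so `E 2 * O ^ 2` approximates `E 1 ^ 2 / E 2`.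
  have h1 : (X : PowerSeries ℤ) ^ (d + 1) ∣ gaussTheta - E 2 * O ^ 2 := by
    obtain ⟨a, ha⟩ := ((pow_dvd_pow X (by omega)).trans (X_pow_dvd_E_one_sub (2 * n)) :
      X ^ (d + 1) ∣ _)
    obtain ⟨b, hb⟩ := X_pow_dvd_expand two_ne_zero
      ((pow_dvd_pow X (by omega)).trans (X_pow_dvd_E_one_sub n) : X ^ (d + 1) ∣ _)
    rw [map_sub, expand_E _ one_ne_zero] at hb
    have h := eulerProd_two_mul n
    rw [← hO] at h
    rw [show eulerProd (2 * n) = E 1 - X ^ (d + 1) * a by linear_combination -ha,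
      show expand 2 two_ne_zero (eulerProd n) = E 2 - X ^ (d + 1) * b by
        linear_combination -hb] at h
    have hi : E 2 * invE 2 = 1 := E_mul_invE (by norm_num)
    refine ⟨invE 2 * ((a - O * b) * (E 1 + E 2 * O)), ?_⟩
    rw [gaussTheta]
    linear_combination invE 2 * (E 1 + E 2 * O) * h + E 2 * O ^ 2 * hi
  rw [coeff_eq_of_X_pow_dvd_sub h1 (Nat.lt_succ_self d)]
  have h2 : coeff d (E 2 * ((-1) ^ n * O ^ 2)) = 0 := by
    rw [prod_odd_sq_eq_sum, Finset.mul_sum, map_sum]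
    refine Finset.sum_eq_zero fun k hk ↦ ?_
    have hk' : k ≤ 2 * n := by have := Finset.mem_range.mp hk; omega
    have hz : coeff d (X ^ (((k : ℤ) - n) ^ 2).toNat *
        (gaussBinom (X ^ 2) (2 * n) k * E 2)) = 0 := by
      have h2t := Int.toNat_of_nonneg (sq_nonneg ((k : ℤ) - n))
      apply coeff_X_pow_mul_eq_zero (M := d + 1)
      by_cases hc : d + 1 ≤ k ∧ d + 1 ≤ 2 * n - k
      · right
        refine ⟨?_, ?_, Nat.lt_succ_self d⟩
        · intro ht
          rw [ht] at h2t
          generalize (k : ℤ) - n = j at h2t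
          have h5 : (j * j) % 5 = 2 ∨ (j * j) % 5 = 3 := by
            rw [← sq]; omega
          have h6 : j % 5 = 0 ∨ j % 5 = 1 ∨ j % 5 = 2 ∨ j % 5 = 3 ∨ j % 5 = 4 := by omega
          rcases h6 with h | h | h | h | h <;> simp [Int.mul_emod, h] at h5
        · have := X_pow_dvd_expand two_ne_zero (X_pow_dvd_gaussBinom_mul_E_one_sub hc.1 hc.2)
          rw [Nat.add_sub_cancel' hk', map_sub, map_mul, expand_E _ one_ne_zero, map_one] at this
          have h3 := map_gaussBinom
            (expand (R := ℤ) 2 two_ne_zero : PowerSeries ℤ →ₐ[ℤ] PowerSeries ℤ).toRingHom X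
            (2 * n) k
          simp only [AlgHom.toRingHom_eq_coe, RingHom.coe_coe, expand_X] at h3
          rwa [h3] at this
      · left
        zify
        rw [h2t]
        rcases not_and_or.mp hc with hc | hc
        · have : (n : ℤ) - k ≥ d + 1 := by omega
          nlinarith
        · have : (k : ℤ) - n ≥ d + 1 := by omega
          nlinarith
    have e : E 2 * ((-1) ^ k * X ^ (((k : ℤ) - n) ^ 2).toNat *
        gaussBinom (X ^ 2) (2 * n) k) = (-1) ^ k *
        (X ^ (((k : ℤ) - n) ^ 2).toNat * (gaussBinom (X ^ 2) (2 * n) k * E 2)) := by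
      ring
    rw [e]
    exact coeff_neg_one_pow_mul_eq_zero hz
  rw [mul_left_comm] at h2
  have h3 := coeff_neg_one_pow_mul_eq_zero (k := n) h2
  rwa [← mul_assoc, ← pow_add, Even.neg_one_pow ⟨n, rfl⟩, one_mul] at h3

theorem U_two_gaussTheta : U 2 gaussTheta = 0 := by
  ext m
  rw [coeff_U, coeff_gaussTheta_eq_zero (by omega), map_zero]

theorem U_three_gaussTheta : U 3 gaussTheta = 0 := by
  ext m
  rw [coeff_U, coeff_gaussTheta_eq_zero (by omega), map_zero]

/-! ### Norms over the fifth roots of unity. -/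

theorem norm_quadratic_of_fifth_root {R : Type*} [CommRing R] {ζ : R}
    (h : 1 + ζ + ζ ^ 2 + ζ ^ 3 + ζ ^ 4 = 0) {a b c : R} (hac : a * c = b ^ 2) :
    (a - b - c) * (a - ζ * b - ζ ^ 2 * c) * (a - ζ ^ 2 * b - ζ ^ 4 * c) *
      (a - ζ ^ 3 * b - ζ ^ 6 * c) * (a - ζ ^ 4 * b - ζ ^ 8 * c) =
    a ^ 5 - 11 * b ^ 5 - c ^ 5 := by
  have h5 : ζ ^ 5 = 1 := by linear_combination (ζ - 1) * h
  have h6 : ζ ^ 6 = ζ := by linear_combination ζ * h5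
  have h8 : ζ ^ 8 = ζ ^ 3 := by linear_combination ζ ^ 3 * h5
  rw [h6, h8]
  have h4 : ζ ^ 4 = -1 - ζ - ζ ^ 2 - ζ ^ 3 := by linear_combination h
  have e1 : (a - ζ * b - ζ ^ 2 * c) * (a - ζ ^ 4 * b - ζ ^ 3 * c) =
    a ^ 2 + b ^ 2 + c ^ 2 - (ζ + ζ ^ 4) * (a * b - b * c) - (ζ ^ 2 + ζ ^ 3) * (a * c) := by
    linear_combination (b ^ 2 + c ^ 2 + ζ * b * c) * h5
  have e2 : (a - ζ ^ 2 * b - ζ ^ 4 * c) * (a - ζ ^ 3 * b - ζ * c) =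
    a ^ 2 + b ^ 2 + c ^ 2 - (ζ ^ 2 + ζ ^ 3) * (a * b - b * c) - (ζ + ζ ^ 4) * (a * c) := by
    linear_combination (b ^ 2 + c ^ 2 + ζ ^ 2 * b * c) * h5
  -- After pairing conjugate factors only the periods `ζ + ζ ^ 4` and `ζ ^ 2 + ζ ^ 3` remain. They
  -- have sum -1 and product -1, so the check takes place in one variable `p`.
  have e3 : (ζ + ζ ^ 4) * (ζ ^ 2 + ζ ^ 3) = -1 := by linear_combination h + (ζ + ζ ^ 2) * h5
  have e4 : ζ + ζ ^ 4 = -1 - (ζ ^ 2 + ζ ^ 3) := by linear_combination h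
  rw [show (a - b - c) * (a - ζ * b - ζ ^ 2 * c) * (a - ζ ^ 2 * b - ζ ^ 4 * c) *
      (a - ζ ^ 3 * b - ζ * c) * (a - ζ ^ 4 * b - ζ ^ 3 * c) = (a - b - c) *
      ((a - ζ * b - ζ ^ 2 * c) * (a - ζ ^ 4 * b - ζ ^ 3 * c)) *
      ((a - ζ ^ 2 * b - ζ ^ 4 * c) * (a - ζ ^ 3 * b - ζ * c)) by ring, e1, e2]
  rw [e4] at e3 ⊢
  generalize ζ ^ 2 + ζ ^ 3 = p at *
  clear h h4 h5 h6 h8 e1 e2 e4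
  grind

theorem norm_linear_of_fifth_root {R : Type*} [CommRing R] {η : R}
    (h : 1 + η + η ^ 2 + η ^ 3 + η ^ 4 = 0) (y : R) :
    (1 - y) * (1 - η * y) * (1 - η ^ 2 * y) * (1 - η ^ 3 * y) * (1 - η ^ 4 * y) = 1 - y ^ 5 := by
  have h5 : η ^ 5 = 1 := by linear_combination (η - 1) * h
  have e1 : (1 - η * y) * (1 - η ^ 4 * y) = 1 + y ^ 2 - (η + η ^ 4) * y := by
    linear_combination y ^ 2 * h5
  have e2 : (1 - η ^ 2 * y) * (1 - η ^ 3 * y) = 1 + y ^ 2 - (η ^ 2 + η ^ 3) * y := by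
    linear_combination y ^ 2 * h5
  have e3 : (η + η ^ 4) * (η ^ 2 + η ^ 3) = -1 := by linear_combination h + (η + η ^ 2) * h5
  have e4 : η + η ^ 4 = -1 - (η ^ 2 + η ^ 3) := by linear_combination h
  rw [show (1 - y) * (1 - η * y) * (1 - η ^ 2 * y) * (1 - η ^ 3 * y) * (1 - η ^ 4 * y) =
    (1 - y) * ((1 - η * y) * (1 - η ^ 4 * y)) * ((1 - η ^ 2 * y) * (1 - η ^ 3 * y)) by ring,
    e1, e2]
  rw [e4] at e3 ⊢
  generalize η ^ 2 + η ^ 3 = p at *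
  clear h h5 e1 e2 e4
  grind

/-- A primitive fifth root of unity. -/
noncomputable def fifthRoot : ℂ := Complex.exp (2 * Real.pi * Complex.I / (5 : ℕ))

theorem isPrimitiveRoot_fifthRoot : IsPrimitiveRoot fifthRoot 5 :=
  Complex.isPrimitiveRoot_exp 5 (by norm_num)

theorem sum_pow_eq_zero_of_isPrimitiveRoot {η : ℂ} (h : IsPrimitiveRoot η 5) :
    1 + η + η ^ 2 + η ^ 3 + η ^ 4 = 0 := by
  have := h.geom_sum_eq_zero (by norm_num)
  simpa [Finset.sum_range_succ] using this

/-- The substitution `q ↦ ζ ^ i q` for a primitive fifth root of unity `ζ`. -/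
noncomputable def twist (i : ℕ) : PowerSeries ℤ →+* PowerSeries ℂ :=
  (rescale (fifthRoot ^ i)).comp (PowerSeries.map (Int.castRingHom ℂ))

theorem twist_X (i : ℕ) : twist i X = C (fifthRoot ^ i) * X := by
  simp [twist, rescale_X]

theorem twist_V (i : ℕ) (f : PowerSeries ℤ) :
    twist i (V f) = PowerSeries.map (Int.castRingHom ℂ) (V f) := by
  ext n
  rw [twist, RingHom.comp_apply, coeff_rescale, coeff_map, coeff_V]
  split_ifs with h
  · obtain ⟨k, rfl⟩ := h
    rw [← pow_mul, show i * (5 * k) = 5 * (i * k) by ring, pow_mul,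
      isPrimitiveRoot_fifthRoot.pow_eq_one, one_pow, one_mul]
  · simp

/-- The product of the conjugates of a power series under `q ↦ ζ q`. -/
noncomputable def conjProd : PowerSeries ℤ →* PowerSeries ℂ where
  toFun f := twist 0 f * twist 1 f * twist 2 f * twist 3 f * twist 4 f
  map_one' := by simp
  map_mul' f g := by simp only [map_mul]; ring

theorem conjProd_apply (f : PowerSeries ℤ) :
    conjProd f = twist 0 f * twist 1 f * twist 2 f * twist 3 f * twist 4 f := rfl

theorem X_pow_dvd_twist {M i : ℕ} {f : PowerSeries ℤ} (h : X ^ M ∣ f) : X ^ M ∣ twist i f := by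
  obtain ⟨g, rfl⟩ := h
  rw [map_mul, map_pow, twist_X, mul_pow, mul_assoc, mul_left_comm]
  exact dvd_mul_right _ _

theorem X_pow_dvd_conjProd_sub {M : ℕ} {f g : PowerSeries ℤ} (h : X ^ M ∣ f - g) :
    X ^ M ∣ conjProd f - conjProd g := by
  have ht : ∀ i, X ^ M ∣ twist i f - twist i g := fun i ↦ by
    rw [← map_sub]; exact X_pow_dvd_twist h
  exact dvd_mul_sub_mul (dvd_mul_sub_mul (dvd_mul_sub_mul (dvd_mul_sub_mul (ht 0) (ht 1))
    (ht 2)) (ht 3)) (ht 4)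

theorem conjProd_one_sub_X_pow_of_not_dvd {n : ℕ} (hn : ¬ 5 ∣ n) :
    conjProd (1 - X ^ n) = 1 - X ^ (5 * n) := by
  have hp : IsPrimitiveRoot (fifthRoot ^ n) 5 :=
    isPrimitiveRoot_fifthRoot.pow_of_coprime n
      ((Nat.Prime.coprime_iff_not_dvd (by norm_num)).mpr hn).symm
  have h := congrArg (C : ℂ →+* PowerSeries ℂ) (sum_pow_eq_zero_of_isPrimitiveRoot hp)
  simp only [map_add, map_pow, map_one, map_zero] at h
  have := norm_linear_of_fifth_root h (X ^ n)
  rw [conjProd_apply]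
  simp only [map_sub, map_one, map_pow, twist_X]
  rw [mul_comm 5 n, pow_mul, ← this]
  ring

theorem conjProd_one_sub_X_pow_five_mul (n : ℕ) :
    conjProd (1 - X ^ (5 * n)) = (1 - X ^ (5 * n)) ^ 5 := by
  have h : (1 - X ^ (5 * n) : PowerSeries ℤ) = V (1 - X ^ n) := by
    rw [map_sub, map_pow, V_X, map_one, ← pow_mul]
  rw [conjProd_apply, h]
  simp only [twist_V]
  rw [← h, map_sub, map_pow, map_X, map_one]
  ring

/-- A factor `1 - q ^ i` has norm `1 - q ^ (5 i)` if 5 does not divide `i`, and norm `(1 - q ^ i) ^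
5` otherwise. The extra factor on the left supplies the terms `1 - q ^ (5 i)` with `5 ∣ i`, avoiding
a quotient. -/
theorem conjProd_eulerProd (N : ℕ) :
    conjProd (eulerProd (5 * N)) * PowerSeries.map (Int.castRingHom ℂ) (V (V (eulerProd N))) =
      PowerSeries.map (Int.castRingHom ℂ) (V (eulerProd (5 * N)) * V (eulerProd N) ^ 5) := by
  induction N with
  | zero => simp [eulerProd]
  | succ N ih =>
    rw [show 5 * (N + 1) = 5 * N + 1 + 1 + 1 + 1 + 1 by ring]
    simp only [eulerProd_succ, map_mul, map_pow]
    rw [conjProd_one_sub_X_pow_of_not_dvd (by omega), conjProd_one_sub_X_pow_of_not_dvd (by omega),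
      conjProd_one_sub_X_pow_of_not_dvd (by omega), conjProd_one_sub_X_pow_of_not_dvd (by omega),
      show 5 * N + 1 + 1 + 1 + 1 + 1 = 5 * (N + 1) by ring, conjProd_one_sub_X_pow_five_mul]
    simp only [map_mul, map_pow] at ih
    simp only [map_sub, map_one, map_pow, V_X, map_X, ← pow_mul]
    rw [show 5 * (5 * (N + 1)) = 5 * 5 * (N + 1) by ring]
    linear_combination (1 - X ^ (5 * (5 * N + 1))) * (1 - X ^ (5 * (5 * N + 1 + 1))) *
      (1 - X ^ (5 * (5 * N + 1 + 1 + 1))) * (1 - X ^ (5 * (5 * N + 1 + 1 + 1 + 1))) *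
      (1 - X ^ (5 * (N + 1))) ^ 5 * (1 - X ^ (5 * 5 * (N + 1))) * ih

theorem X_pow_dvd_map {M : ℕ} {f : PowerSeries ℤ} (h : X ^ M ∣ f) :
    X ^ M ∣ PowerSeries.map (Int.castRingHom ℂ) f := by
  obtain ⟨g, rfl⟩ := h
  rw [map_mul, map_pow, map_X]
  exact dvd_mul_right _ _

theorem conjProd_E_one_mul :
    conjProd (E 1) * PowerSeries.map (Int.castRingHom ℂ) (E 25) =
      PowerSeries.map (Int.castRingHom ℂ) (E 5 ^ 6) := by
  have hX : ∀ M : ℕ, X ^ M ∣ conjProd (E 1) * PowerSeries.map (Int.castRingHom ℂ) (E 25) -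
      PowerSeries.map (Int.castRingHom ℂ) (E 5 ^ 6) := by
    intro M
    have hV : ∀ N, M ≤ N → X ^ M ∣ V (E 1) - V (eulerProd N) := fun N hN ↦ by
      rw [← map_sub]
      exact X_pow_dvd_expand _ ((pow_dvd_pow X (by omega)).trans (X_pow_dvd_E_one_sub N))
    have hVV : X ^ M ∣ V (V (E 1)) - V (V (eulerProd M)) := by
      rw [← map_sub]
      exact X_pow_dvd_expand _ (hV M le_rfl)
    have h1 : X ^ M ∣ E 1 - eulerProd (5 * M) :=
      (pow_dvd_pow X (by omega)).trans (X_pow_dvd_E_one_sub (5 * M))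
    have h2 := X_pow_dvd_map hVV
    rw [map_sub] at h2
    have h3 := dvd_mul_sub_mul (X_pow_dvd_conjProd_sub h1) h2
    rw [conjProd_eulerProd] at h3
    have h4 := X_pow_dvd_map (dvd_mul_sub_mul (hV (5 * M) (by omega))
      ((hV M le_rfl).trans (sub_dvd_pow_sub_pow _ _ 5)))
    rw [map_sub] at h4
    have h5 := h3.sub h4
    rw [V_E one_ne_zero, V_E (by norm_num), sub_sub_sub_cancel_right, mul_one, ← pow_succ'] at h5
    exact h5
  rw [← sub_eq_zero]
  ext n
  rw [X_pow_dvd_iff.mp (hX (n + 1)) n (Nat.lt_succ_self n), map_zero]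

/-! ### The 5-dissection of `E 1`. -/

theorem E_one_eq_pentagonalSeries : E 1 = pentagonalSeries ℤ := by
  rw [← WithPiTopology.tprod_one_sub_X_pow, E, qPochhammer]
  simp only [pow_one, ← pow_succ']

/-- The indices `1 - 5 k` are those whose pentagonal number is 1 modulo 5, so this component of `E
1` reproduces the whole series in `q ^ 25`, with opposite sign. -/
theorem pentagonal_one_sub_five_mul (k : ℤ) :
    pentagonal (1 - 5 * k) = 25 * pentagonal k + 1 := by
  have h1 := two_mul_natCast_pentagonal k
  have h2 := two_mul_natCast_pentagonal (1 - 5 * k)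
  zify
  linarith

theorem pentagonal_mod_five (k : ℤ) : pentagonal k % 5 = 0 ∨ pentagonal k % 5 = 2 ∨
    (pentagonal k % 5 = 1 ∧ ∃ j, k = 1 - 5 * j) := by
  have h := two_mul_natCast_pentagonal k
  obtain ⟨j, r, hr, hr', rfl⟩ : ∃ j r : ℤ, 0 ≤ r ∧ r < 5 ∧ k = r - 5 * j :=
    ⟨-(k / 5), k % 5, by omega, by omega, by omega⟩
  generalize pentagonal (r - 5 * j) = p at *
  have h' : 2 * (p : ℤ) = 5 * (-6 * j * r + 15 * j * j + j) + r * (3 * r - 1) := by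
    rw [h]; ring
  generalize -6 * j * r + 15 * j * j + j = t at h'
  interval_cases r
  · left; omega
  · right; right; exact ⟨by omega, j, rfl⟩
  · left; omega
  · right; left; omega
  · right; left; omega

theorem U_one_E_one : U 1 (E 1) = -V (E 1) := by
  ext n
  rw [coeff_U, map_neg, coeff_V, E_one_eq_pentagonalSeries]
  by_cases h : 5 * n + 1 ∈ Set.range pentagonal
  · obtain ⟨k, hk⟩ := h
    rcases pentagonal_mod_five k with h1 | h1 | ⟨h1, j, rfl⟩
    · omega
    · omega
    · rw [← hk, coeff_pentagonalSeries_pentagonal]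
      rw [pentagonal_one_sub_five_mul] at hk
      have hn : n = 5 * pentagonal j := by omega
      subst hn
      rw [if_pos (dvd_mul_right _ _), Nat.mul_div_cancel_left _ (by norm_num),
        coeff_pentagonalSeries_pentagonal]
      rcases Int.even_or_odd j with he | ho
      · rw [Int.negOnePow_even _ he, Int.negOnePow_odd _ (by grind)]
        simp
      · rw [Int.negOnePow_odd _ ho, Int.negOnePow_even _ (by grind)]
        simp
  · rw [coeff_pentagonalSeries_eq_zero _ h]
    split_ifs with h5
    · obtain ⟨m, rfl⟩ := h5
      rw [Nat.mul_div_cancel_left _ (by norm_num), coeff_pentagonalSeries_eq_zero, neg_zero]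
      rintro ⟨k, rfl⟩
      exact h ⟨1 - 5 * k, by rw [pentagonal_one_sub_five_mul]; ring⟩
    · simp

theorem U_E_one_eq_zero {r : ℕ} (hr : r = 3 ∨ r = 4) : U r (E 1) = 0 := by
  ext n
  rw [coeff_U, map_zero, E_one_eq_pentagonalSeries]
  apply coeff_pentagonalSeries_eq_zero
  rintro ⟨k, hk⟩
  rcases pentagonal_mod_five k with h1 | h1 | ⟨h1, -⟩ <;> omega

theorem ofNat_ne_zero (n : ℕ) [n.AtLeastTwo] : (OfNat.ofNat n : PowerSeries ℤ) ≠ 0 := by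
  intro h
  have := congrArg (constantCoeff (R := ℤ)) h
  rw [map_ofNat, map_zero] at this
  exact OfNat.ofNat_ne_zero n this

theorem V_expand_two (f : PowerSeries ℤ) :
    expand 2 two_ne_zero (V f) = V (expand 2 two_ne_zero f) := by
  rw [V_apply, V_apply, ← expand_mul, ← expand_mul]

theorem E_one_eq_U : E 1 = V (U 0 (E 1)) - X * V (E 5) + X ^ 2 * V (U 2 (E 1)) := by
  have h := eq_sum_X_pow_mul_V_U (E 1)
  simp only [Finset.sum_range_succ, Finset.sum_range_zero, U_one_E_one,
    U_E_one_eq_zero (Or.inl rfl), U_E_one_eq_zero (Or.inr rfl), V_E one_ne_zero] at h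
  rw [map_neg] at h
  simp only [map_zero] at h
  linear_combination h

/-- The residue 2 component of `E 1 ^ 3` is `3 a (a d + E 5 ^ 2)`, where `a` and `d` are the
components 0 and 2 of `E 1`. It vanishes by Jacobi's identity, and `a` is nonzero. -/
theorem U_zero_mul_U_two : U 0 (E 1) * U 2 (E 1) = -E 5 ^ 2 := by
  have h := U_two_E_one_pow_three
  have hE := E_one_eq_U
  set a := U 0 (E 1) with ha
  set d := U 2 (E 1) with hd
  rw [hE, show (V a - X * V (E 5) + X ^ 2 * V d) ^ 3 =
    V (a ^ 3 - 3 * X * E 5 * d ^ 2) +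
    X * V (-3 * a ^ 2 * E 5 + X * d ^ 3) + X ^ 2 * V (3 * a * E 5 ^ 2 + 3 * a ^ 2 * d) +
    X ^ 3 * V (-E 5 ^ 3 - 6 * a * E 5 * d) + X ^ 4 * V (3 * a * d ^ 2 + 3 * E 5 ^ 2 * d) by
      simp only [map_add, map_mul, map_pow, map_neg, map_ofNat, V_X, map_sub]
      ring, U_sum (by norm_num)] at h
  simp only [OfNat.ofNat_ne_zero, OfNat.ofNat_ne_one, if_true, if_false] at h
  have ha0 : a ≠ 0 := by
    intro h0
    have := congrArg (coeff 0) (ha.symm.trans h0)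
    rw [coeff_U, map_zero, coeff_zero_eq_constantCoeff_apply, constantCoeff_E le_rfl] at this
    exact one_ne_zero this
  have h3 : (3 * a) * (a * d + E 5 ^ 2) = 0 := by linear_combination h
  have := (mul_eq_zero.mp h3).resolve_left (mul_ne_zero (ofNat_ne_zero 3) ha0)
  linear_combination this

/-- The `5`-dissection of `E 1`, with `x = 1 / R(q)` for the Rogers–Ramanujan continued
fraction `R`, together with the relation between `R(q)`, `E 1` and `E 5`. -/
theorem exists_dissection_E_one : ∃ x y : PowerSeries ℤ, x * y = 1 ∧
    E 1 = V (E 5) * (V x - X - X ^ 2 * V y) ∧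
    E 1 ^ 6 = E 5 ^ 6 * (x ^ 5 - 11 * X - X ^ 2 * y ^ 5) := by
  have hinv : E 5 * invE 5 = 1 := E_mul_invE (by norm_num)
  have hV := congrArg V hinv
  rw [map_mul, map_one] at hV
  have h02 := U_zero_mul_U_two
  have hE := E_one_eq_U
  set a := U 0 (E 1)
  set d := U 2 (E 1)
  have hxy : a * invE 5 * (-d * invE 5) = 1 := by
    linear_combination -(invE 5) ^ 2 * h02 + (E 5 * invE 5 + 1) * hinv
  have hd : E 1 = V (E 5) * (V (a * invE 5) - X - X ^ 2 * V (-d * invE 5)) := by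
    rw [hE]
    simp only [map_mul, map_neg]
    linear_combination -(V a + X ^ 2 * V d) * hV
  refine ⟨a * invE 5, -d * invE 5, hxy, hd, ?_⟩
  generalize a * invE 5 = x at *
  generalize -d * invE 5 = y at *
  clear hE h02
  have hnorm := conjProd_E_one_mul
  set ι := PowerSeries.map (Int.castRingHom ℂ) with hι
  have hζ := congrArg (C : ℂ →+* PowerSeries ℂ)
    (sum_pow_eq_zero_of_isPrimitiveRoot isPrimitiveRoot_fifthRoot)
  simp only [map_add, map_pow, map_one, map_zero] at hζ
  have hac : ι (V x) * (X ^ 2 * ι (V y)) = X ^ 2 := by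
    rw [mul_left_comm, ← map_mul, ← map_mul, hxy, map_one, map_one, mul_one]
  have hq := norm_quadratic_of_fifth_root hζ hac
  have ht : ∀ i, twist i (E 1) = ι (V (E 5)) *
      (ι (V x) - C fifthRoot ^ i * X - C fifthRoot ^ (2 * i) * (X ^ 2 * ι (V y))) := by
    intro i
    rw [hd]
    simp only [map_mul, map_sub, map_pow, twist_V, twist_X]
    ring
  -- The norm of `E 1` is computed twice: from the product it is `E 5 ^ 6 / E 25`, from the
  -- dissection it is the quintic form in `x` and `y`. Cancelling `V` then replaces `q ^ 5` by `q`.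
  rw [conjProd_apply, ht, ht, ht, ht, ht] at hnorm
  have hV5 : V (E 5) = E 25 := V_E (by norm_num)
  have hfin : ι (E 5 ^ 6) = ι (V (E 5 ^ 6 * (x ^ 5 - 11 * X - X ^ 2 * y ^ 5))) := by
    rw [← hnorm, ← hV5]
    simp only [map_mul, map_sub, map_pow, map_ofNat, V_X, hι, map_X] at hq ⊢
    linear_combination (PowerSeries.map (Int.castRingHom ℂ) (V (E 5))) ^ 6 * hq
  apply V_injective
  rw [map_pow, V_E one_ne_zero]
  exact PowerSeries.map_injective _ (Int.cast_injective) hfin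

/-! ### The level 10 parametrization by `k`. -/

/-- The parametrization of the `5`-dissections of `E 1` and `E 2` in level `10`. -/
theorem exists_parametrization : ∃ x y m n k u : PowerSeries ℤ,
    x * y = 1 ∧ m * n = 1 ∧ (1 - k) * u = 1 ∧ m * (1 - k) = 1 + k ∧ k = X * y ^ 5 * m ^ 2 ∧
    E 1 = V (E 5) * (V x - X - X ^ 2 * V y) ∧
    E 2 = V (E 10) * (V (x ^ 2 * n) - X ^ 2 - X ^ 4 * V (y ^ 2 * m)) ∧
    E 1 ^ 6 = E 5 ^ 6 * (x ^ 5 - 11 * X - X ^ 2 * y ^ 5) ∧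
    E 2 ^ 6 = E 10 ^ 6 * ((x ^ 2 * n) ^ 5 - 11 * X ^ 2 - X ^ 4 * (y ^ 2 * m) ^ 5) := by
  obtain ⟨x, y, hxy, hE1, hN1⟩ := exists_dissection_E_one
  have hzw := congrArg (expand (R := ℤ) 2 two_ne_zero) hxy
  have hE2 := congrArg (expand (R := ℤ) 2 two_ne_zero) hE1
  have hN2 := congrArg (expand (R := ℤ) 2 two_ne_zero) hN1
  simp only [map_mul, map_sub, map_pow, map_one, map_ofNat, V_expand_two, expand_X,
    expand_E _ one_ne_zero, expand_E _ (show 5 ≠ 0 by norm_num), ← pow_mul] at hzw hE2 hN2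
  norm_num at hE2 hN2
  set z := expand (R := ℤ) 2 two_ne_zero x
  set w := expand (R := ℤ) 2 two_ne_zero y
  have hphi := E_two_mul_gaussTheta
  have hsum := eq_sum_X_pow_mul_V_U gaussTheta
  simp only [Finset.sum_range_succ, Finset.sum_range_zero, U_two_gaussTheta,
    U_three_gaussTheta, map_zero] at hsum
  set f₀ := U 0 gaussTheta
  set f₁ := U 1 gaussTheta
  set f₄ := U 4 gaussTheta
  have hVxy := congrArg V hxy
  have hVzw := congrArg V hzw
  rw [map_mul, map_one] at hVxy hVzw
  have hL : E 1 ^ 2 = V (E 5 ^ 2 * x ^ 2) + X * V (-2 * E 5 ^ 2 * x) + X ^ 2 * V (-E 5 ^ 2) +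
      X ^ 3 * V (2 * E 5 ^ 2 * y) + X ^ 4 * V (E 5 ^ 2 * y ^ 2) := by
    rw [hE1]
    simp only [map_mul, map_neg, map_pow, map_ofNat]
    linear_combination -2 * X ^ 2 * (V (E 5)) ^ 2 * hVxy
  have hR : E 2 * gaussTheta = V (E 10 * (z * f₀ - X * w * f₁)) +
      X * V (E 10 * (z * f₁ - X * f₄)) + X ^ 2 * V (-E 10 * f₀) +
      X ^ 3 * V (-E 10 * (f₁ + X * w * f₄)) + X ^ 4 * V (E 10 * (z * f₄ - w * f₀)) := by
    rw [hE2, hsum]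
    simp only [map_mul, map_neg, map_sub, map_add, V_X]
    ring
  rw [hL, hR] at hphi
  have h1 := congrArg (U 1) hphi
  have h2 := congrArg (U 2) hphi
  have h3 := congrArg (U 3) hphi
  have h4 := congrArg (U 4) hphi
  rw [U_sum (by norm_num), U_sum (by norm_num)] at h1 h2 h3 h4
  simp only [one_ne_zero, OfNat.ofNat_ne_zero, OfNat.ofNat_ne_one, if_true, if_false, Nat.reduceEqDiff] at h1 h2 h3 h4
  -- Component 2 of `E 2 * gaussTheta = E 1 ^ 2` gives `f₀`, component 4 then gives `f₄`, and
  -- eliminating `f₁` between components 1 and 3 leaves a relation between the continued fractions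
  -- at `q` and `q ^ 2`.
  have hrel : y * z - x = -X * w * (y ^ 2 + w) := by
    have h5 : (2 : PowerSeries ℤ) * E 5 ^ 2 ≠ 0 :=
      mul_ne_zero (ofNat_ne_zero 2) (pow_ne_zero _ (E_ne_zero (by norm_num)))
    apply mul_left_cancel₀ h5
    have hg : E 10 * f₄ = E 5 ^ 2 * w * (y ^ 2 + w) := by
      linear_combination w * h4 - E 10 * f₄ * hzw - w ^ 2 * h2
    linear_combination -h1 - z * h3 - 2 * X * hg - X * E 10 * f₄ * hzw
  have hmn : w * x ^ 2 * (z * y ^ 2) = 1 := by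
    linear_combination x ^ 2 * y ^ 2 * hzw + (x * y + 1) * hxy
  set m := w * x ^ 2 with hm
  set k := X * y ^ 5 * m ^ 2 with hk
  -- Multiplied by `y * w * x ^ 2`, the relation `hrel` reads `1 - m = -k * (1 + m)`, because `k = X
  -- * y * w ^ 2`.
  have hmk : m * (1 - k) = 1 + k := by
    have hy : y ^ 2 * m = w := by rw [hm]; linear_combination w * (x * y + 1) * hxy
    have hk2 : k = X * y * w ^ 2 := by rw [hk, ← hy]; ring
    rw [hk2, hm]
    linear_combination -(y * w * x ^ 2) * hrel + x ^ 2 * y ^ 2 * hzw + (x * y + 1) * hxy -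
      x ^ 2 * w * hxy + X * y * w ^ 2 * (x * y + 1) * hxy
  have hu : (1 - k) * invOfUnit (1 - k) 1 = 1 := mul_invOfUnit _ _ (by simp [hk])
  refine ⟨x, y, m, z * y ^ 2, k, invOfUnit (1 - k) 1, hxy, hmn, hu, hmk, hk, hE1, ?_, hN1, ?_⟩
  · rw [show x ^ 2 * (z * y ^ 2) = z by linear_combination z * (x * y + 1) * hxy,
      show y ^ 2 * m = w by rw [hm]; linear_combination w * (x * y + 1) * hxy]
    exact hE2
  · rw [show x ^ 2 * (z * y ^ 2) = z by linear_combination z * (x * y + 1) * hxy,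
      show y ^ 2 * m = w by rw [hm]; linear_combination w * (x * y + 1) * hxy]
    linear_combination hN2

-- Rational function identities in `k`.

universe v

section LevelTen
variable {R : Type v} [CommRing R] [IsDomain R] {k m n : R}

/-- Identities between rational functions of `k`, where `m = (1 + k) / (1 - k)` and `n = 1 / m`,
may be checked in a field. -/
theorem eq_of_forall_field {f g : R} (hk : 1 - k ≠ 0) (hm : m * (1 - k) = 1 + k)
    (hn : m * n = 1) (h : ∀ (K : Type v) [Field K] (φ : R →+* K), 1 - φ k ≠ 0 → 1 + φ k ≠ 0 →
      φ m = (1 + φ k) / (1 - φ k) → φ n = (1 - φ k) / (1 + φ k) → φ f = φ g) : f = g := by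
  have hinj := IsFractionRing.injective R (FractionRing R)
  set φ := algebraMap R (FractionRing R)
  have h1 : 1 - φ k ≠ 0 := by
    rw [← map_one φ, ← map_sub]
    exact (map_ne_zero_iff φ hinj).mpr hk
  have hm' : φ m * (1 - φ k) = 1 + φ k := by
    have := congrArg φ hm
    simpa using this
  have hn' : φ m * φ n = 1 := by
    have := congrArg φ hn
    simpa using this
  have h2 : 1 + φ k ≠ 0 := by
    rw [← hm']
    exact mul_ne_zero (left_ne_zero_of_mul_eq_one hn') h1
  have e1 : φ m = (1 + φ k) / (1 - φ k) := by rw [eq_div_iff h1, hm']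
  refine hinj (h _ φ h1 h2 e1 ?_)
  rw [e1] at hn'
  rw [eq_div_iff h2]
  field_simp at hn'
  linear_combination hn'

/-- Since `X * y ^ 5 = k * n ^ 2`, the first factor is the quintic norm form divided by `x ^ 5`. The
factorization expresses `E 1 ^ 6` through `k`; `norm_two_eq_of_k` does the same for `E 2 ^ 6`. -/
theorem norm_eq_of_k (hk : 1 - k ≠ 0) (hm : m * (1 - k) = 1 + k) (hn : m * n = 1) :
    (1 - 11 * (k * n ^ 2) - (k * n ^ 2) ^ 2) * (1 + k) ^ 4 =
      (1 - 4 * k - k ^ 2) ^ 2 * (1 + k - k ^ 2) := by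
  refine eq_of_forall_field hk hm hn fun K _ φ h1 h2 e1 e2 ↦ ?_
  simp only [map_mul, map_add, map_sub, map_pow, map_one, map_ofNat, e2]
  field_simp
  ring

theorem norm_two_eq_of_k (hk : 1 - k ≠ 0) (hm : m * (1 - k) = 1 + k) (hn : m * n = 1) :
    (1 - 11 * (k ^ 2 * m) - (k ^ 2 * m) ^ 2) * (1 - k) ^ 2 =
      (1 - 4 * k - k ^ 2) * (1 + k - k ^ 2) ^ 2 := by
  refine eq_of_forall_field hk hm hn fun K _ φ h1 h2 e1 e2 ↦ ?_
  simp only [map_mul, map_add, map_sub, map_pow, map_one, map_ofNat, e1]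
  field_simp
  ring

/-- The bracket compares component 4 of `E 2 * E 1 ^ 7` with `(n + 1 - m + 10) * E 1 ^ 6`, common
factors removed. Clearing denominators makes the factor 25 visible. -/
theorem class_four_seven_one (hk : 1 - k ≠ 0) (hm : m * (1 - k) = 1 + k) (hn : m * n = 1)
    {σ : R} (hσ : σ = k * n ^ 2) :
    (n * (-49 - 14 * m - m ^ 2 + 14 * σ + 29 * σ * m - 14 * σ * m ^ 2 - σ ^ 2 + 14 * σ ^ 2 * m -
      49 * σ ^ 2 * m ^ 2) -
        (n + 1 - m + 10) * (1 - 11 * σ - σ ^ 2)) * ((1 - k) * (1 + k) ^ 5) =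
      25 * (-3 - 2 * k - 8 * k ^ 2 - 10 * k ^ 3 + 22 * k ^ 4 + 10 * k ^ 5 - 8 * k ^ 6 +
        2 * k ^ 7 - 3 * k ^ 8) := by
  subst hσ
  refine eq_of_forall_field hk hm hn fun K _ φ h1 h2 e1 e2 ↦ ?_
  simp only [map_mul, map_add, map_sub, map_pow, map_one, map_ofNat, map_neg, e1, e2]
  field_simp
  ring

end LevelTen

/-- The coefficient of `s ^ 0` in `(1 - s - s²)⁴ (1 - m s² - m² s⁴)⁴`, as a polynomial
in `σ = s ^ 5`. -/
def dissectionCoeff0 {R : Type*} [CommRing R] (σ m : R) : R :=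
  1 - 8 * σ - 32 * σ * m - 8 * σ * m ^ 2 - 4 * σ ^ 2 * m + 4 * σ ^ 2 * m ^ 2 - 40 * σ ^ 2 * m ^
    3 - 10 * σ ^ 2 * m ^ 4 - 8 * σ ^ 2 * m ^ 5 - 20 * σ ^ 3 * m ^ 4 + 64 * σ ^ 3 * m ^ 5 + 16 * σ
    ^ 3 * m ^ 6 - 16 * σ ^ 3 * m ^ 7 + 2 * σ ^ 4 * m ^ 6 + 8 * σ ^ 4 * m ^ 7 - 5 * σ ^ 4 * m ^ 8

/-- The coefficient of `s ^ 1` in `(1 - s - s²)⁴ (1 - m s² - m² s⁴)⁴`, as a polynomial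
in `σ = s ^ 5`. -/
def dissectionCoeff1 {R : Type*} [CommRing R] (σ m : R) : R :=
  -4 + 2 * σ + 20 * σ * m + 4 * σ * m ^ 2 + 8 * σ * m ^ 3 + 8 * σ ^ 2 * m ^ 2 - 64 * σ ^ 2 * m ^
    3 - 40 * σ ^ 2 * m ^ 4 + 32 * σ ^ 2 * m ^ 5 - 5 * σ ^ 3 * m ^ 4 - 16 * σ ^ 3 * m ^ 5 - 10 * σ
    ^ 3 * m ^ 6 + 8 * σ ^ 3 * m ^ 7 + σ ^ 3 * m ^ 8 + 16 * σ ^ 4 * m ^ 7 - 8 * σ ^ 4 * m ^ 8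

/-- The coefficient of `s ^ 2` in `(1 - s - s²)⁴ (1 - m s² - m² s⁴)⁴`, as a polynomial
in `σ = s ^ 5`. -/
def dissectionCoeff2 {R : Type*} [CommRing R] (σ m : R) : R :=
  2 - 4 * m + 4 * σ + 32 * σ * m + 16 * σ * m ^ 2 - 32 * σ * m ^ 3 + 2 * σ ^ 2 * m ^ 2 + 16 * σ
    ^ 2 * m ^ 3 + 25 * σ ^ 2 * m ^ 4 - 16 * σ ^ 2 * m ^ 5 + 2 * σ ^ 2 * m ^ 6 - 32 * σ ^ 3 * m ^ 5
    - 16 * σ ^ 3 * m ^ 6 + 32 * σ ^ 3 * m ^ 7 - 4 * σ ^ 3 * m ^ 8 + 4 * σ ^ 4 * m ^ 7 + 2 * σ ^ 4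
    * m ^ 8

/-- The coefficient of `s ^ 3` in `(1 - s - s²)⁴ (1 - m s² - m² s⁴)⁴`, as a polynomial
in `σ = s ^ 5`. -/
def dissectionCoeff3 {R : Type*} [CommRing R] (σ m : R) : R :=
  8 + 16 * m + σ - 8 * σ * m - 10 * σ * m ^ 2 + 16 * σ * m ^ 3 - 5 * σ * m ^ 4 + 32 * σ ^ 2 * m
    ^ 3 + 40 * σ ^ 2 * m ^ 4 - 64 * σ ^ 2 * m ^ 5 - 8 * σ ^ 2 * m ^ 6 - 8 * σ ^ 3 * m ^ 5 + 4 * σ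
    ^ 3 * m ^ 6 - 20 * σ ^ 3 * m ^ 7 + 2 * σ ^ 3 * m ^ 8 + 4 * σ ^ 4 * m ^ 8

/-- The coefficient of `s ^ 4` in `(1 - s - s²)⁴ (1 - m s² - m² s⁴)⁴`, as a polynomial
in `σ = s ^ 5`. -/
def dissectionCoeff4 {R : Type*} [CommRing R] (σ m : R) : R :=
  -5 - 8 * m + 2 * m ^ 2 - 16 * σ * m - 16 * σ * m ^ 2 + 64 * σ * m ^ 3 + 20 * σ * m ^ 4 + 8 * σ
    ^ 2 * m ^ 3 - 10 * σ ^ 2 * m ^ 4 + 40 * σ ^ 2 * m ^ 5 + 4 * σ ^ 2 * m ^ 6 + 4 * σ ^ 2 * m ^ 7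
    + 8 * σ ^ 3 * m ^ 6 - 32 * σ ^ 3 * m ^ 7 + 8 * σ ^ 3 * m ^ 8 + σ ^ 4 * m ^ 8

theorem dissection_pow_four {R : Type*} [CommRing R] (s m : R) :
    (1 - s - s ^ 2) ^ 4 * (1 - m * s ^ 2 - m ^ 2 * s ^ 4) ^ 4 =
      dissectionCoeff0 (s ^ 5) m + s * dissectionCoeff1 (s ^ 5) m +
      s ^ 2 * dissectionCoeff2 (s ^ 5) m + s ^ 3 * dissectionCoeff3 (s ^ 5) m +
      s ^ 4 * dissectionCoeff4 (s ^ 5) m := by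
  simp only [dissectionCoeff0, dissectionCoeff1, dissectionCoeff2, dissectionCoeff3,
    dissectionCoeff4]
  ring

/-- The middle factor on the left is the `s ^ 4` component of the square of `dissection_pow_four`.
The two terms on the right correspond to the eigenvalue -210 and to `5 ^ 7` from weight 8. -/
theorem hecke_identity {R : Type*} [CommRing R] [IsDomain R] {k m n σ : R} (hk : 1 - k ≠ 0)
    (hm : m * (1 - k) = 1 + k) (hn : m * n = 1) (hσ : σ = k * n ^ 2) :
    n ^ 8 * (2 * dissectionCoeff0 σ m * dissectionCoeff4 σ m +
        2 * dissectionCoeff1 σ m * dissectionCoeff3 σ m + dissectionCoeff2 σ m ^ 2) *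
        (1 + k) ^ 12 =
      -210 * ((1 - k) * (1 - 4 * k - k ^ 2) * (1 + k - k ^ 2)) ^ 4 -
        5 ^ 7 * σ ^ 4 * (1 + k) ^ 12 := by
  subst hσ
  refine eq_of_forall_field hk hm hn fun K _ φ h1 h2 e1 e2 ↦ ?_
  simp only [dissectionCoeff0, dissectionCoeff1, dissectionCoeff2, dissectionCoeff3,
    dissectionCoeff4, map_mul, map_add, map_sub, map_pow, map_one, map_ofNat, map_neg, e1, e2]
  field_simp
  ring

/-- The series `x, y, m, n, k, u` parametrize the `5`-dissections of `E 1` and `E 2`: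
`1 / x = y` is the Rogers–Ramanujan continued fraction and `k` is Ramanujan's parameter. -/
structure IsLevelTenParam (x y m n k u : PowerSeries ℤ) : Prop where
  x_mul_y : x * y = 1
  m_mul_n : m * n = 1
  one_sub_k_mul_u : (1 - k) * u = 1
  m_mul_one_sub_k : m * (1 - k) = 1 + k
  k_eq : k = X * y ^ 5 * m ^ 2
  E_one_eq : E 1 = V (E 5) * (V x - X - X ^ 2 * V y)
  E_two_eq : E 2 = V (E 10) * (V (x ^ 2 * n) - X ^ 2 - X ^ 4 * V (y ^ 2 * m))
  E_one_pow_six : E 1 ^ 6 = E 5 ^ 6 * (x ^ 5 - 11 * X - X ^ 2 * y ^ 5)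
  E_two_pow_six :
    E 2 ^ 6 = E 10 ^ 6 * ((x ^ 2 * n) ^ 5 - 11 * X ^ 2 - X ^ 4 * (y ^ 2 * m) ^ 5)

theorem exists_isLevelTenParam : ∃ x y m n k u, IsLevelTenParam x y m n k u := by
  obtain ⟨x, y, m, n, k, u, h1, h2, h3, h4, h5, h6, h7, h8, h9⟩ := exists_parametrization
  exact ⟨x, y, m, n, k, u, h1, h2, h3, h4, h5, h6, h7, h8, h9⟩

theorem eq_of_pow_three_eq {f g : PowerSeries ℤ} (hf : constantCoeff f = 1)
    (hg : constantCoeff g = 1) (h : f ^ 3 = g ^ 3) : f = g := by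
  have h1 : (f - g) * (f ^ 2 + f * g + g ^ 2) = 0 := by linear_combination h
  refine sub_eq_zero.mp ((mul_eq_zero.mp h1).resolve_right fun h2 ↦ ?_)
  have := congrArg (constantCoeff (R := ℤ)) h2
  simp [hf, hg] at this

/-! ### Euler products in terms of `k`, and their images under `U`. -/

namespace IsLevelTenParam

variable {x y m n k u : PowerSeries ℤ} (h : IsLevelTenParam x y m n k u)
include h

theorem one_sub_k_ne_zero : 1 - k ≠ 0 := left_ne_zero_of_mul_eq_one h.one_sub_k_mul_u

theorem n_mul_one_add_k : n * (1 + k) = 1 - k := by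
  linear_combination (1 - k) * h.m_mul_n - n * h.m_mul_one_sub_k

theorem one_add_k_mul : (1 + k) * (n * u) = 1 := by
  linear_combination u * h.n_mul_one_add_k + h.one_sub_k_mul_u

theorem one_add_k_ne_zero : 1 + k ≠ 0 := left_ne_zero_of_mul_eq_one h.one_add_k_mul

theorem X_mul_y_pow : X * y ^ 5 = k * n ^ 2 := by
  rw [h.k_eq]
  linear_combination -(X * y ^ 5 * (m * n + 1)) * h.m_mul_n

theorem x_pow_mul_y_pow (i : ℕ) : x ^ i * y ^ i = 1 := by
  rw [← mul_pow, h.x_mul_y, one_pow]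

theorem m_pow_mul_n_pow (i : ℕ) : m ^ i * n ^ i = 1 := by
  rw [← mul_pow, h.m_mul_n, one_pow]

theorem X_eq : X = k * n ^ 2 * x ^ 5 := by
  linear_combination x ^ 5 * h.X_mul_y_pow - X * h.x_pow_mul_y_pow 5

theorem constantCoeff_k : constantCoeff k = 0 := by
  rw [h.k_eq]
  simp

theorem constantCoeff_m : constantCoeff m = 1 := by
  have := congrArg (constantCoeff (R := ℤ)) h.m_mul_one_sub_k
  simpa [h.constantCoeff_k] using this

theorem constantCoeff_n : constantCoeff n = 1 := by
  have := congrArg (constantCoeff (R := ℤ)) h.m_mul_n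
  simpa [h.constantCoeff_m] using this

theorem E_one_pow_six_eq :
    E 1 ^ 6 = E 5 ^ 6 * x ^ 5 * (1 - 11 * (k * n ^ 2) - (k * n ^ 2) ^ 2) := by
  have hX := h.X_eq
  rw [h.E_one_pow_six]
  linear_combination E 5 ^ 6 * (-11 - y ^ 5 * (X + k * n ^ 2 * x ^ 5)) * hX -
    E 5 ^ 6 * k ^ 2 * n ^ 4 * x ^ 5 * h.x_pow_mul_y_pow 5

theorem E_one_pow_six_mul : E 1 ^ 6 * (1 + k) ^ 4 =
    E 5 ^ 6 * x ^ 5 * (1 - 4 * k - k ^ 2) ^ 2 * (1 + k - k ^ 2) := by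
  linear_combination (1 + k) ^ 4 * h.E_one_pow_six_eq + E 5 ^ 6 * x ^ 5 *
    norm_eq_of_k h.one_sub_k_ne_zero h.m_mul_one_sub_k h.m_mul_n

theorem E_two_pow_six_mul : E 2 ^ 6 * (1 - k) ^ 2 =
    E 10 ^ 6 * x ^ 10 * n ^ 5 * (1 - 4 * k - k ^ 2) * (1 + k - k ^ 2) ^ 2 := by
  have h2 : X ^ 2 = k ^ 2 * m * (x ^ 10 * n ^ 5) := by
    have := congrArg (· ^ 2) h.X_eq
    linear_combination this - k ^ 2 * n ^ 4 * x ^ 10 * h.m_mul_n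
  have h1 : E 2 ^ 6 =
      E 10 ^ 6 * x ^ 10 * n ^ 5 * (1 - 11 * (k ^ 2 * m) - (k ^ 2 * m) ^ 2) := by
    rw [h.E_two_pow_six]
    linear_combination E 10 ^ 6 * (-11 - y ^ 10 * m ^ 5 *
      (X ^ 2 + k ^ 2 * m * (x ^ 10 * n ^ 5))) * h2 -
      E 10 ^ 6 * (k ^ 2 * m) ^ 2 * x ^ 10 * n ^ 5 * (m ^ 5 * n ^ 5 * h.x_pow_mul_y_pow 10 +
        h.m_pow_mul_n_pow 5)
  linear_combination (1 - k) ^ 2 * h1 + E 10 ^ 6 * x ^ 10 * n ^ 5 *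
    norm_two_eq_of_k h.one_sub_k_ne_zero h.m_mul_one_sub_k h.m_mul_n

theorem theta_mul : (n + 1 - m) * ((1 - k) * (1 + k)) = 1 - 4 * k - k ^ 2 := by
  linear_combination (1 - k) * h.n_mul_one_add_k - (1 + k) * h.m_mul_one_sub_k

/-- The quotient `(E 1 ^ 2 / E 2) ^ 2 / (E 5 ^ 2 / E 10) ^ 2` in terms of `m`. -/
theorem theta_sq_eq : E 1 ^ 4 * E 10 ^ 2 = (n + 1 - m) * E 2 ^ 2 * E 5 ^ 4 := by
  -- Only the sixth powers of `E 1` and `E 2` are known through `k`, so the cubes are compared;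
  -- constant term 1 makes the cube root unique.
  apply eq_of_pow_three_eq
  · simp [constantCoeff_E]
  · simp [constantCoeff_E, h.constantCoeff_m, h.constantCoeff_n]
  have s1 := congrArg (· ^ 2) h.E_one_pow_six_mul
  have s2 := h.E_two_pow_six_mul
  have s3 := congrArg (· ^ 3) h.theta_mul
  have s4 := congrArg (· ^ 5) h.n_mul_one_add_k
  have hc : (1 + k) ^ 11 * (1 - k) ^ 5 ≠ 0 :=
    mul_ne_zero (pow_ne_zero _ h.one_add_k_ne_zero) (pow_ne_zero _ h.one_sub_k_ne_zero)
  apply mul_right_cancel₀ hc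
  linear_combination E 10 ^ 6 * (1 + k) ^ 3 * (1 - k) ^ 5 * s1 -
    E 5 ^ 12 * (1 + k) ^ 8 * E 2 ^ 6 * (1 - k) ^ 2 * s3 -
    E 5 ^ 12 * (1 + k) ^ 8 * (1 - 4 * k - k ^ 2) ^ 3 * s2 -
    E 5 ^ 12 * E 10 ^ 6 * x ^ 10 * (1 - 4 * k - k ^ 2) ^ 4 * (1 + k - k ^ 2) ^ 2 *
      (1 + k) ^ 3 * s4

/-- Dividing `E 1 ^ 6` by `E 1 ^ 4 / E 2 ^ 2`, both known in terms of `k`, leaves `(E 1 * E 2) ^ 2`.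
Its fourth power enters the Hecke relation. -/
theorem E_one_mul_E_two_sq : (E 1 * E 2) ^ 2 * (1 + k) ^ 3 =
    (1 - k) * (1 - 4 * k - k ^ 2) * (1 + k - k ^ 2) * x ^ 5 * (E 5 * E 10) ^ 2 := by
  have hp : (1 - 4 * k - k ^ 2) * E 5 ^ 4 ≠ 0 := by
    refine mul_ne_zero (fun h0 ↦ ?_) (pow_ne_zero _ (E_ne_zero (by norm_num)))
    have := congrArg (constantCoeff (R := ℤ)) h0
    simp [h.constantCoeff_k] at this
  apply mul_left_cancel₀ hp
  linear_combination (1 - k) * E 10 ^ 2 * h.E_one_pow_six_mul -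
    E 5 ^ 4 * E 1 ^ 2 * E 2 ^ 2 * (1 + k) ^ 3 * h.theta_mul -
    (1 - k) * (1 + k) ^ 4 * E 1 ^ 2 * h.theta_sq_eq

theorem E_one_eq_mul :
    E 1 = V (E 5 * x) * (1 - X * V y - (X * V y) ^ 2) := by
  have hV := congrArg V h.x_mul_y
  rw [map_mul, map_one] at hV
  rw [h.E_one_eq, map_mul]
  linear_combination V (E 5) * (X + X ^ 2 * V y) * hV

theorem E_two_eq_mul : E 2 = V (E 10 * x ^ 2 * n) *
    (1 - V m * (X * V y) ^ 2 - V m ^ 2 * (X * V y) ^ 4) := by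
  have hx := congrArg V h.x_mul_y
  have hm := congrArg V h.m_mul_n
  rw [map_mul, map_one] at hx hm
  rw [h.E_two_eq]
  simp only [map_mul, map_pow]
  linear_combination V (E 10) * (X ^ 2 * V m * V n + X ^ 4 * V y ^ 2 * V m ^ 2 * V n) *
    (V x * V y + 1) * hx + V (E 10) * (X ^ 2 + X ^ 4 * V y ^ 2 * V m) * hm

theorem X_mul_V_y_pow_five : (X * V y) ^ 5 = V (k * n ^ 2) := by
  rw [← h.X_mul_y_pow, map_mul, map_pow, V_X]
  ring

omit h in
-- The variable `s = X * V y` has `s ^ 5` in the image of `V`, so the powers of `s` modulo 5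
-- separate the residue classes.
theorem U_four_of_dissection {F c g₀ g₁ g₂ g₃ g₄ : PowerSeries ℤ}
    (hF : F = V c * (V g₀ + X * V y * V g₁ + (X * V y) ^ 2 * V g₂ + (X * V y) ^ 3 * V g₃ +
      (X * V y) ^ 4 * V g₄)) : U 4 F = c * (y ^ 4 * g₄) := by
  rw [hF, U_V_mul (by norm_num), show V g₀ + X * V y * V g₁ + (X * V y) ^ 2 * V g₂ +
    (X * V y) ^ 3 * V g₃ + (X * V y) ^ 4 * V g₄ = V g₀ + X * V (y * g₁) + X ^ 2 * V (y ^ 2 * g₂) +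
      X ^ 3 * V (y ^ 3 * g₃) + X ^ 4 * V (y ^ 4 * g₄) by simp only [map_mul, map_pow]; ring,
    U_sum (by norm_num)]
  simp

theorem U_four_two_one :
    U 4 (E 2 * E 1 ^ 2) = E 10 * E 5 ^ 2 * (n + 1 - m) := by
  have hs := h.X_mul_V_y_pow_five
  obtain ⟨σ, hσ⟩ : ∃ σ, σ = k * n ^ 2 := ⟨_, rfl⟩
  rw [← hσ] at hs
  -- The `gᵢ` come from expanding `(1 - s - s ^ 2) ^ 2 * (1 - m * s ^ 2 - m ^ 2 * s ^ 4)` and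
  -- collecting exponents modulo 5, with `σ` standing for `s ^ 5`. The analogous data below arise in
  -- the same way.
  have hU := U_four_of_dissection (y := y) (c := E 10 * x ^ 2 * n * (E 5 * x) ^ 2)
    (F := E 2 ^ 1 * E 1 ^ 2)
    (g₀ := 1 - 2 * σ * m + 2 * σ * m ^ 2)
    (g₁ := -2 - σ * m + σ * m ^ 2)
    (g₂ := -1 - m - 2 * σ * m ^ 2)
    (g₃ := 2 + 2 * m - σ * m ^ 2)
    (g₄ := 1 + m - m ^ 2) (by
      rw [h.E_one_eq_mul, h.E_two_eq_mul]
      simp only [map_mul, map_add, map_sub, map_neg, map_pow, map_ofNat, map_one, ← hs]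
      ring)
  rw [pow_one] at hU
  rw [hU]
  linear_combination E 10 * E 5 ^ 2 * n * (1 + m - m ^ 2) * h.x_pow_mul_y_pow 4 +
    E 10 * E 5 ^ 2 * (1 - m) * h.m_mul_n

theorem U_four_seven_one :
    ∃ D, U 4 (E 2 * E 1 ^ 7) = E 10 * E 5 * (n + 1 - m + 10) * E 1 ^ 6 + 25 * D := by
  have hs := h.X_mul_V_y_pow_five
  obtain ⟨σ, hσ⟩ : ∃ σ, σ = k * n ^ 2 := ⟨_, rfl⟩
  rw [← hσ] at hs
  have hU := U_four_of_dissection (y := y) (c := E 10 * x ^ 2 * n * (E 5 * x) ^ 7)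
    (F := E 2 ^ 1 * E 1 ^ 7)
    (g₀ := 1 + 14 * σ - 7 * σ * m + 7 * σ * m ^ 2 + 49 * σ ^ 2 + 77 * σ ^ 2 * m - 77 * σ ^ 2 * m
      ^ 2 + 7 * σ ^ 3 * m - 7 * σ ^ 3 * m ^ 2)
    (g₁ := -7 + 77 * σ + 49 * σ * m - 14 * σ * m ^ 2 + 7 * σ ^ 2 - 14 * σ ^ 2 * m + 29 * σ ^ 2 *
      m ^ 2 + σ ^ 3 * m + 14 * σ ^ 3 * m ^ 2)
    (g₂ := 14 - m - 29 * σ - 14 * σ * m - 7 * σ * m ^ 2 - 14 * σ ^ 2 - 49 * σ ^ 2 * m + 77 * σ ^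
      2 * m ^ 2 + 7 * σ ^ 3 * m ^ 2)
    (g₃ := 7 + 7 * m - 77 * σ - 77 * σ * m + 49 * σ * m ^ 2 - 7 * σ ^ 2 - 7 * σ ^ 2 * m - 14 * σ
      ^ 2 * m ^ 2 + σ ^ 3 * m ^ 2)
    (g₄ := -49 - 14 * m - m ^ 2 + 14 * σ + 29 * σ * m - 14 * σ * m ^ 2 - σ ^ 2 + 14 * σ ^ 2 * m
      - 49 * σ ^ 2 * m ^ 2) (by
      rw [h.E_one_eq_mul, h.E_two_eq_mul]
      simp only [map_mul, map_add, map_sub, map_neg, map_pow, map_ofNat, map_one, ← hs]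
      ring)
  rw [pow_one] at hU
  have h71 := class_four_seven_one h.one_sub_k_ne_zero h.m_mul_one_sub_k h.m_mul_n hσ
  set P := -3 - 2 * k - 8 * k ^ 2 - 10 * k ^ 3 + 22 * k ^ 4 + 10 * k ^ 5 - 8 * k ^ 6 +
        2 * k ^ 7 - 3 * k ^ 8
  -- The denominator in `class_four_seven_one` is a unit, so divisibility by 25 survives in integral
  -- power series.
  have hu : ((1 - k) * (1 + k) ^ 5) * (u * (n * u) ^ 5) = 1 := by
    have h5 : (1 + k) ^ 5 * (n * u) ^ 5 = 1 := by rw [← mul_pow, h.one_add_k_mul, one_pow]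
    linear_combination (1 + k) ^ 5 * (n * u) ^ 5 * h.one_sub_k_mul_u + h5
  have h6 := h.E_one_pow_six_eq
  rw [← hσ] at h6
  refine ⟨E 10 * E 5 ^ 7 * x ^ 5 * (u * (n * u) ^ 5) * P, ?_⟩
  rw [hU]
  linear_combination E 10 * E 5 ^ 7 * x ^ 5 * (u * (n * u) ^ 5) * h71 -
    E 10 * E 5 * (n + 1 - m + 10) * h6 + E 10 * E 5 ^ 7 * x ^ 5 * n *
      (-49 - 14 * m - m ^ 2 + 14 * σ + 29 * σ * m - 14 * σ * m ^ 2 - σ ^ 2 + 14 * σ ^ 2 * m - 49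
        * σ ^ 2 * m ^ 2) * h.x_pow_mul_y_pow 4 -
    E 10 * E 5 ^ 7 * x ^ 5 * (n * (-49 - 14 * m - m ^ 2 + 14 * σ + 29 * σ * m - 14 * σ * m ^ 2 -
      σ ^ 2 + 14 * σ ^ 2 * m - 49 * σ ^ 2 * m ^ 2) -
        (n + 1 - m + 10) * (1 - 11 * σ - σ ^ 2)) * hu

/-- Component 4 collapses to the single term `25 * σ * m ^ 3`, and `σ * x ^ 5 = X`. -/
theorem U_four_three_three :
    U 4 ((E 1 * E 2) ^ 3) = 25 * X * (E 5 * E 10) ^ 3 := by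
  have hs := h.X_mul_V_y_pow_five
  obtain ⟨σ, hσ⟩ : ∃ σ, σ = k * n ^ 2 := ⟨_, rfl⟩
  rw [← hσ] at hs
  have hU := U_four_of_dissection (y := y) (c := (E 10 * x ^ 2 * n) ^ 3 * (E 5 * x) ^ 3)
    (F := E 2 ^ 3 * E 1 ^ 3)
    (g₀ := 1 - 3 * σ - 15 * σ * m - 3 * σ ^ 2 * m ^ 5 + 9 * σ ^ 3 * m ^ 5 - 5 * σ ^ 3 * m ^ 6)
    (g₁ := -3 - σ + 5 * σ * m ^ 3 - 15 * σ ^ 2 * m ^ 3 + 9 * σ ^ 2 * m ^ 5 + 3 * σ ^ 3 * m ^ 5)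
    (g₂ := -3 * m + 9 * σ * m - 15 * σ * m ^ 3 - 5 * σ ^ 2 * m ^ 3 - σ ^ 2 * m ^ 6 + 3 * σ ^ 3 *
      m ^ 6)
    (g₃ := 5 + 9 * m + 3 * σ * m - 15 * σ ^ 2 * m ^ 5 + 3 * σ ^ 2 * m ^ 6 + σ ^ 3 * m ^ 6)
    (g₄ := 25 * σ * m ^ 3) (by
      rw [h.E_one_eq_mul, h.E_two_eq_mul]
      simp only [map_mul, map_add, map_sub, map_neg, map_pow, map_ofNat, map_one, ← hs]
      ring)
  rw [mul_pow, mul_comm, hU]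
  have hX := h.X_eq
  rw [← hσ] at hX
  rw [hX]
  linear_combination 25 * σ * (E 5 * E 10) ^ 3 * x ^ 5 * (m ^ 3 * n ^ 3 *
    h.x_pow_mul_y_pow 4 + h.m_pow_mul_n_pow 3)

/-- The action of the fifth Hecke operator on `E 1 ^ 8 * E 2 ^ 8`. -/
theorem U_four_eight_eight : U 4 ((E 1 * E 2) ^ 8) =
    -210 * (E 1 * E 2) ^ 8 - 5 ^ 7 * X ^ 4 * (E 5 * E 10) ^ 8 := by
  have hs := h.X_mul_V_y_pow_five
  obtain ⟨σ, hσ⟩ : ∃ σ, σ = k * n ^ 2 := ⟨_, rfl⟩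
  rw [← hσ] at hs
  have hd := dissection_pow_four (X * V y) (V m)
  rw [hs] at hd
  have e0 : dissectionCoeff0 (V σ) (V m) = V (dissectionCoeff0 σ m) := by
    simp only [dissectionCoeff0, map_add, map_sub, map_mul, map_pow, map_ofNat, map_one]
  have e1 : dissectionCoeff1 (V σ) (V m) = V (dissectionCoeff1 σ m) := by
    simp only [dissectionCoeff1, map_add, map_sub, map_mul, map_pow, map_neg, map_ofNat]
  have e2 : dissectionCoeff2 (V σ) (V m) = V (dissectionCoeff2 σ m) := by
    simp only [dissectionCoeff2, map_add, map_sub, map_mul, map_pow, map_ofNat]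
  have e3 : dissectionCoeff3 (V σ) (V m) = V (dissectionCoeff3 σ m) := by
    simp only [dissectionCoeff3, map_add, map_sub, map_mul, map_pow, map_ofNat]
  have e4 : dissectionCoeff4 (V σ) (V m) = V (dissectionCoeff4 σ m) := by
    simp only [dissectionCoeff4, map_add, map_sub, map_mul, map_pow, map_neg, map_ofNat]
  rw [e0, e1, e2, e3, e4] at hd
  have hh := hecke_identity h.one_sub_k_ne_zero h.m_mul_one_sub_k h.m_mul_n hσ
  generalize dissectionCoeff0 σ m = g₀ at *
  generalize dissectionCoeff1 σ m = g₁ at *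
  generalize dissectionCoeff2 σ m = g₂ at *
  generalize dissectionCoeff3 σ m = g₃ at *
  generalize dissectionCoeff4 σ m = g₄ at *
  have hU := U_four_of_dissection (y := y) (c := (E 10 * x ^ 2 * n) ^ 8 * (E 5 * x) ^ 8)
    (F := (E 1 * E 2) ^ 8)
    (g₀ := g₀ ^ 2 + 2 * σ * (g₁ * g₄ + g₂ * g₃))
    (g₁ := 2 * g₀ * g₁ + σ * (2 * g₂ * g₄ + g₃ ^ 2))
    (g₂ := 2 * g₀ * g₂ + g₁ ^ 2 + 2 * σ * (g₃ * g₄))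
    (g₃ := 2 * g₀ * g₃ + 2 * g₁ * g₂ + σ * g₄ ^ 2)
    (g₄ := 2 * g₀ * g₄ + 2 * g₁ * g₃ + g₂ ^ 2) (by
      have h8 : (E 1 * E 2) ^ 8 = V ((E 10 * x ^ 2 * n) ^ 8 * (E 5 * x) ^ 8) *
          ((1 - X * V y - (X * V y) ^ 2) ^ 4 *
            (1 - V m * (X * V y) ^ 2 - V m ^ 2 * (X * V y) ^ 4) ^ 4) ^ 2 := by
        rw [h.E_one_eq_mul, h.E_two_eq_mul]
        simp only [map_mul, map_pow]
        ring
      rw [h8, hd]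
      simp only [map_mul, map_add, map_pow, map_ofNat, ← hs]
      ring)
  have hX := congrArg (· ^ 4) h.X_eq
  have h12 := congrArg (· ^ 4) h.E_one_mul_E_two_sq
  simp only [← hσ] at hX h12
  rw [hU, hX]
  apply mul_right_cancel₀ (pow_ne_zero 12 h.one_add_k_ne_zero)
  linear_combination (E 5 * E 10) ^ 8 * x ^ 20 * hh + 210 * h12 +
    (E 5 * E 10) ^ 8 * x ^ 20 * n ^ 8 * (2 * g₀ * g₄ + 2 * g₁ * g₃ + g₂ ^ 2) * (1 + k) ^ 12 *
      h.x_pow_mul_y_pow 4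

theorem U_four_four_zero :
    U 4 (E 1 ^ 4) = -5 * E 5 ^ 4 := by
  have hs := h.X_mul_V_y_pow_five
  obtain ⟨σ, hσ⟩ : ∃ σ, σ = k * n ^ 2 := ⟨_, rfl⟩
  rw [← hσ] at hs
  have hU := U_four_of_dissection (y := y) (c := (E 5 * x) ^ 4)
    (F := E 2 ^ 0 * E 1 ^ 4)
    (g₀ := 1 - 8 * σ)
    (g₁ := -4 + 2 * σ)
    (g₂ := 2 + 4 * σ)
    (g₃ := 8 + σ)
    (g₄ := -5) (by
      rw [h.E_one_eq_mul, h.E_two_eq_mul]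
      simp only [map_mul, map_add, map_sub, map_neg, map_pow, map_ofNat, map_one, ← hs]
      ring)
  rw [pow_zero, one_mul] at hU
  rw [hU]
  linear_combination -5 * E 5 ^ 4 * h.x_pow_mul_y_pow 4

/-- In the fourth power of the dissection of `E 2` the middle term is `-5 * q ^ 8`, and 8 is 3
modulo 5: this is the `-5` of `U_four_four_zero` with `q ^ 2` for `q`. -/
theorem U_three_zero_four : U 3 (E 2 ^ 4) = -5 * X * E 10 ^ 4 := by
  have hz : V (x ^ 2 * n) * V (y ^ 2 * m) = 1 := by
    rw [← map_mul, ← map_one V]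
    congr 1
    linear_combination m * n * h.x_pow_mul_y_pow 2 + h.m_mul_n
  have hE := h.E_two_eq
  generalize x ^ 2 * n = z at *
  generalize y ^ 2 * m = w at *
  have h2 : (V z - X ^ 2 - X ^ 4 * V w) ^ 2 = V z ^ 2 - 2 * X ^ 2 * V z - X ^ 4 +
      2 * X ^ 6 * V w + X ^ 8 * V w ^ 2 := by
    linear_combination -2 * X ^ 4 * hz
  have hd : E 2 ^ 4 = V (E 10 ^ 4) * (V (z ^ 4 - 8 * X ^ 2 * w) +
      X * V (8 * X * z + X ^ 3 * w ^ 4) + X ^ 2 * V (-4 * z ^ 3 + 2 * X ^ 2 * w ^ 2) +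
      X ^ 3 * V (-5 * X) + X ^ 4 * V (2 * z ^ 2 + 4 * X ^ 2 * w ^ 3)) := by
    rw [hE, mul_pow, show (V z - X ^ 2 - X ^ 4 * V w) ^ 4 = ((V z - X ^ 2 - X ^ 4 * V w) ^ 2) ^ 2 by
      ring, h2]
    simp only [map_mul, map_add, map_sub, map_pow, map_neg, map_ofNat, V_X]
    linear_combination V (E 10) ^ 4 * (4 * X ^ 6 * V z - 8 * X ^ 8 - 4 * X ^ 10 * V w +
      2 * X ^ 8 * (V z * V w + 1)) * hz
  rw [hd, U_V_mul (by norm_num), U_sum (by norm_num)]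
  simp
  ring

end IsLevelTenParam

/-! ### The congruences modulo 25. -/

theorem dvd_of_dvd_mul_E {d f : PowerSeries ℤ} {i j : ℕ} (h : d ∣ E 1 ^ i * E 2 ^ j * f) :
    d ∣ f := by
  have h1 : E 1 * invE 1 = 1 := E_mul_invE le_rfl
  have h2 : E 2 * invE 2 = 1 := E_mul_invE (by norm_num)
  have hu : IsUnit (E 1 ^ i * E 2 ^ j) :=
    ((IsUnit.of_mul_eq_one _ h1).pow i).mul ((IsUnit.of_mul_eq_one _ h2).pow j)
  exact hu.dvd_mul_left.mp h

theorem coeff_U_U_U (n : ℕ) :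
    coeff n (U 3 (U 4 (U 4 (E 2 * invE 1 ^ 3)))) = c (125 * n + 99) := by
  rw [coeff_U, coeff_U, coeff_U, c]
  congr 1
  ring_nf

/-- Modulo 25, `E 2 * E 1 ^ 2` and `E 2 * E 1 ^ 7` contribute `2 Φ` and `-(Φ + 10)` times `E 10 * E
5 ^ 3`, once powers of `E 1 ^ 5` are replaced by those of `E 5`. The errors linear in `z` combine to
a multiple of 25. -/
theorem U_four_congr : ∃ w Φ : PowerSeries ℤ, E 1 ^ 4 * E 10 ^ 2 = Φ * E 2 ^ 2 * E 5 ^ 4 ∧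
    E 1 ^ 6 * U 4 (E 2 * invE 1 ^ 3) = E 10 * E 5 ^ 3 * (Φ - 10) + 25 * w := by
  obtain ⟨x, y, m, n, k, u, h⟩ := exists_isLevelTenParam
  obtain ⟨z, hz⟩ := five_dvd_E_one_pow_sub
  obtain ⟨D, hB⟩ := h.U_four_seven_one
  have hA := h.U_four_two_one
  have hΦ := h.theta_sq_eq
  have hi : E 1 * invE 1 = 1 := E_mul_invE le_rfl
  have hF : E 5 ^ 2 * (E 2 * invE 1 ^ 3) = 2 * E 5 * (E 2 * E 1 ^ 2) - E 2 * E 1 ^ 7 +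
      25 * (z ^ 2 * (E 2 * invE 1 ^ 3)) := by
    have hi3 : E 1 ^ 3 * invE 1 ^ 3 = 1 := by rw [← mul_pow, hi, one_pow]
    linear_combination (E 2 * E 1 ^ 2 * (2 * E 5 - E 1 ^ 5)) * hi3 +
      E 2 * invE 1 ^ 3 * (E 1 ^ 5 - E 5 + 5 * z) * hz
  have hU := congrArg (U 4) hF
  have e5 : E 5 = V (E 1) := (V_E one_ne_zero).symm
  rw [e5, ← map_pow, U_V_mul (by norm_num), map_add, map_sub,
    show 2 * V (E 1) * (E 2 * E 1 ^ 2) = V (2 * E 1) * (E 2 * E 1 ^ 2) by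
      rw [map_mul, map_ofNat], U_V_mul (by norm_num)] at hU
  have h25 : U 4 (25 * (z ^ 2 * (E 2 * invE 1 ^ 3))) = 25 * U 4 (z ^ 2 * (E 2 * invE 1 ^ 3)) := by
    simpa using U_mul_const (r := 4) 25 (z ^ 2 * (E 2 * invE 1 ^ 3))
  rw [h25] at hU
  set T := U 4 (z ^ 2 * (E 2 * invE 1 ^ 3))
  generalize n + 1 - m = Φ at *
  refine ⟨-4 * z * E 10 * E 5 ^ 2 - z ^ 2 * E 10 * E 5 * (Φ + 10) - E 1 ^ 4 * D + E 1 ^ 4 * T,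
    Φ, hΦ, ?_⟩
  linear_combination E 1 ^ 4 * hU + 2 * E 1 ^ 5 * hA - E 1 ^ 4 * hB +
    (2 * E 10 * E 5 ^ 2 * Φ - E 10 * E 5 * (Φ + 10) * (E 1 ^ 5 + E 5 + 5 * z)) * hz

/-- Substituting for `Φ` produces `(E 5 E 10) ^ 2`, which modulo 25 equals `2 E 5 E 10 (E 1 E 2) ^ 5
- (E 1 E 2) ^ 10`, again by squaring a congruence modulo 5. Each product is then a series in `q ^ 5`
times one whose image under `U 4` is known. -/
theorem U_four_dvd : (25 : PowerSeries ℤ) ∣ E 5 ^ 3 * E 10 ^ 2 * U 4 (E 2 * invE 1 ^ 3) -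
    (2 * E 5 * E 10 ^ 4 * (E 1 * E 2) ^ 3 - E 10 ^ 3 * (E 1 * E 2) ^ 8 -
      10 * E 10 ^ 3 * E 5 ^ 4 * E 1 ^ 4) := by
  obtain ⟨w, Φ, hΦ, hG⟩ := U_four_congr
  obtain ⟨z, hz⟩ := five_dvd_E_one_pow_sub
  obtain ⟨z₂, hz₂⟩ := five_dvd_E_two_pow_sub
  apply dvd_of_dvd_mul_E (i := 6) (j := 2)
  set Z := z * E 10 + z₂ * E 5 + 5 * z * z₂ with hZ
  refine ⟨E 10 ^ 3 * E 1 ^ 4 * Z ^ 2 + 2 * E 10 ^ 3 * E 5 ^ 4 * E 2 ^ 2 * z * (E 5 + E 1 ^ 5) +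
    E 2 ^ 2 * E 5 ^ 3 * E 10 ^ 2 * w, ?_⟩
  have hpq : E 1 ^ 5 * E 2 ^ 5 - E 5 * E 10 = 5 * Z := by
    rw [hZ]
    linear_combination E 2 ^ 5 * hz + (E 5 + 5 * z) * hz₂
  linear_combination E 2 ^ 2 * E 5 ^ 3 * E 10 ^ 2 * hG - E 10 ^ 3 * E 5 ^ 2 * hΦ +
    E 10 ^ 3 * E 1 ^ 4 * (E 1 ^ 5 * E 2 ^ 5 - E 5 * E 10 + 5 * Z) * hpq +
    10 * E 10 ^ 3 * E 5 ^ 4 * E 2 ^ 2 * (E 5 + E 1 ^ 5) * hz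

/-- The generating function of `c (25 n + 24)` is congruent to `10 E₅ E₁₀ E₂⁴` modulo `25`. -/
theorem U_four_U_four_dvd : (25 : PowerSeries ℤ) ∣
    U 4 (U 4 (E 2 * invE 1 ^ 3)) - 10 * E 5 * E 10 * E 2 ^ 4 := by
  obtain ⟨x, y, m, n, k, u, h⟩ := exists_isLevelTenParam
  obtain ⟨z, hz⟩ := five_dvd_E_one_pow_sub
  obtain ⟨z₂, hz₂⟩ := five_dvd_E_two_pow_sub
  have hd : (25 : PowerSeries ℤ) ∣ _ := intCast_dvd_U (r := 4) (m := 25) (by simpa using U_four_dvd)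
  set G := U 4 (E 2 * invE 1 ^ 3)
  have e5 : E 5 = V (E 1) := (V_E one_ne_zero).symm
  have e10 : E 10 = V (E 2) := (V_E two_ne_zero).symm
  have e : E 5 ^ 3 * E 10 ^ 2 * G - (2 * E 5 * E 10 ^ 4 * (E 1 * E 2) ^ 3 -
      E 10 ^ 3 * (E 1 * E 2) ^ 8 - 10 * E 10 ^ 3 * E 5 ^ 4 * E 1 ^ 4) =
      V (E 1 ^ 3 * E 2 ^ 2) * G - V (2 * E 1 * E 2 ^ 4) * (E 1 * E 2) ^ 3 +
      V (E 2 ^ 3) * (E 1 * E 2) ^ 8 + V (10 * E 2 ^ 3 * E 1 ^ 4) * E 1 ^ 4 := by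
    rw [e5, e10]
    simp only [map_mul, map_pow, map_ofNat]
    ring
  rw [e, map_add, map_add, map_sub, U_V_mul (by norm_num), U_V_mul (by norm_num),
    U_V_mul (by norm_num), U_V_mul (by norm_num), h.U_four_three_three, h.U_four_eight_eight,
    h.U_four_four_zero] at hd
  obtain ⟨T, hT⟩ := hd
  -- Only `210 * E 2 ^ 3 * (E 1 * E 2) ^ 8` survives modulo 25. As 210 is 10 modulo 25, replacing `E
  -- 1 ^ 5 * E 2 ^ 5` by `E 5 * E 10` needs only the congruences modulo 5.
  apply dvd_of_dvd_mul_E (i := 3) (j := 2)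
  refine ⟨T + 2 * E 1 * E 2 ^ 4 * X * (E 5 * E 10) ^ 3 + 8 * E 2 ^ 3 * (E 1 * E 2) ^ 8 +
    3125 * E 2 ^ 3 * X ^ 4 * (E 5 * E 10) ^ 8 + 2 * E 2 ^ 3 * E 1 ^ 4 * E 5 ^ 4 +
    2 * E 1 ^ 3 * E 2 ^ 6 * (z * E 2 ^ 5 + z₂ * E 5), ?_⟩
  linear_combination hT + 10 * E 1 ^ 3 * E 2 ^ 6 * (E 2 ^ 5 * hz + E 5 * hz₂)

theorem theorem2 (n : ℕ) : c (125 * n + 99) ≡ 0 [ZMOD 25] := by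
  obtain ⟨x, y, m, n', k, u, h⟩ := exists_isLevelTenParam
  have hd : (25 : PowerSeries ℤ) ∣ _ :=
    intCast_dvd_U (r := 3) (m := 25) (by simpa using U_four_U_four_dvd)
  have e : 10 * E 5 * E 10 * E 2 ^ 4 = V (10 * E 1 * E 2) * E 2 ^ 4 := by
    rw [map_mul, map_mul, map_ofNat, V_E one_ne_zero, V_E two_ne_zero, mul_one, show 5 * 2 = 10 from rfl]
  -- The factor 5 from `U 3 (E 2 ^ 4)` meets the coefficient 10, so this term is a multiple of 50.
  rw [e, map_sub, U_V_mul (by norm_num), h.U_three_zero_four] at hd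
  have h25 : ((25 : ℤ) : PowerSeries ℤ) ∣ U 3 (U 4 (U 4 (E 2 * invE 1 ^ 3))) := by
    obtain ⟨T, hT⟩ := hd
    refine ⟨T - 2 * E 1 * E 2 * X * E 10 ^ 4, ?_⟩
    push_cast at hT ⊢
    linear_combination hT
  rw [intCast_dvd_iff] at h25
  have := h25 n
  rw [coeff_U_U_U] at this
  exact Int.modEq_zero_iff_dvd.mpr this
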